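/- Let $\mathrm{LG}$ be the class of compact connected (nonempty) subsets of the plane $\mathbb{C}=\mathbb{R}^2$ that are the union of finitely many compact line segments. For a nonempty compact $\sigma\subseteq\mathbb{C}$, a function $f:\sigma\to\mathbb{C}$ and a finite list $S=[x_0,\dots,x_n]$ of (not necessarily distinct) points of $\sigma$ put $\operatorname{cvar}(f,S)=\sum_{i=1}^n|f(x_i)-f(x_{i-1})|$. For a line $\ell$ and $0\le i<n$, the segment $\overline{x_i\,x_{i+1}}$ is a crossing segment of $S$ on $\ell$ if (i) $x_i$ and $x_{i+1}$ lie strictly on opposite sides of $\ell$, or (ii) $i=0$ and $x_0\in\ell$, or (iii) $i>0$, $x_i\in\ell$ and $x_{i-1}\notin\ell$. Let $\operatorname{vf}(S)$ be the maximum, over all lines $\ell$, of the number of crossing segments of $S$ on $\ell$ (and $\operatorname{vf}(S)=1$ if $n=0$). Let $$\operatorname{var}(f,\sigma)=\sup_S\frac{\operatorname{cvar}(f,S)}{\operatorname{vf}(S)},\qquad \|f\|_{BV(\sigma)}=\sup_{z\in\sigma}|f(z)|+\operatorname{var}(f,\sigma).$$ Let $BV(\sigma)$ be the algebra, under pointwise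 operations, of all $f$ with $\|f\|_{BV(\sigma)}<\infty$, and let $AC(\sigma)$ be the closure in $BV(\sigma)$ of the set of restrictions to $\sigma$ of polynomials with complex coefficients in the two real variables $x,y$. **Theorem.** Let $\sigma,\tau\in\mathrm{LG}$. Then $AC(\sigma)$ and $AC(\tau)$ are isomorphic as Banach algebras, that is, there is a linear and multiplicative bijection $\Phi:AC(\sigma)\to AC(\tau)$ such that $\Phi$ and $\Phi^{-1}$ are continuous, if and only if $\sigma$ and $\tau$ are homeomorphic. -/

import Mathlib

open scoped ENNReal

noncomputable section

namespace ACSpace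

/-- The class `LG` of linear graphs: the compact connected (in particular nonempty) subsets of the
plane that are the union of a finite number of compact line segments. -/
def LG : Set (Set ℂ) :=
  {σ | IsCompact σ ∧ IsConnected σ ∧
    ∃ T : Set (ℂ × ℂ), T.Finite ∧ σ = ⋃ p ∈ T, segment ℝ p.1 p.2}

/-- For `u ≠ 0`, the real affine functional whose zero set is the line
`{x + i y | u.re * x + u.im * y = c}`; every line in the plane is of this form.  The two strict
sides of the line are the sets where it is positive, respectively negative. -/
def lineFun (u : ℂ) (c : ℝ) (z : ℂ) : ℝ := u.re * z.re + u.im * z.im - c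

/-- `[x i, x (i+1)]` is a crossing segment of the list `x 0, x 1, …` on the line
`lineFun u c = 0`. -/
def IsCrossing (u : ℂ) (c : ℝ) (x : ℕ → ℂ) (i : ℕ) : Prop :=
  lineFun u c (x i) * lineFun u c (x (i + 1)) < 0 ∨
  (i = 0 ∧ lineFun u c (x i) = 0) ∨
  (0 < i ∧ lineFun u c (x i) = 0 ∧ lineFun u c (x (i - 1)) ≠ 0)

open Classical in
/-- The number of crossing segments of the list `[x 0, …, x n]` on the line `lineFun u c = 0`. -/
def crossings (u : ℂ) (c : ℝ) (x : ℕ → ℂ) (n : ℕ) : ℕ :=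
  ((Finset.range n).filter (IsCrossing u c x)).card

/-- The variation factor of the list `[x 0, …, x n]`: the maximal number of crossing segments on
a line if `n ≥ 1` (see `exists_crossings_eq_vf` for the fact that the supremum is a maximum),
and `1` for a one-element list. -/
def vf (x : ℕ → ℂ) (n : ℕ) : ℕ :=
  if n = 0 then 1 else sSup {k | ∃ (u : ℂ) (c : ℝ), u ≠ 0 ∧ k = crossings u c x n}

theorem crossings_le (u : ℂ) (c : ℝ) (x : ℕ → ℂ) (n : ℕ) : crossings u c x n ≤ n := by
  classical
  unfold crossings
  exact (Finset.card_filter_le _ _).trans (by simp)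

theorem crossings_bddAbove (x : ℕ → ℂ) (n : ℕ) :
    BddAbove {k | ∃ (u : ℂ) (c : ℝ), u ≠ 0 ∧ k = crossings u c x n} :=
  ⟨n, by rintro k ⟨u, c, -, rfl⟩; exact crossings_le u c x n⟩

theorem crossings_le_vf {u : ℂ} (hu : u ≠ 0) (c : ℝ) (x : ℕ → ℂ) (n : ℕ) :
    crossings u c x n ≤ vf x n := by
  by_cases hn : n = 0
  · subst hn; simp [crossings]
  · rw [vf, if_neg hn]
    exact le_csSup (crossings_bddAbove x n) ⟨u, c, hu, rfl⟩

theorem exists_crossings_eq_vf (x : ℕ → ℂ) {n : ℕ} (hn : n ≠ 0) :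
    ∃ (u : ℂ) (c : ℝ), u ≠ 0 ∧ vf x n = crossings u c x n := by
  rw [vf, if_neg hn]
  exact Nat.sSup_mem (s := {k | ∃ (u : ℂ) (c : ℝ), u ≠ 0 ∧ k = crossings u c x n})
    ⟨_, 1, 0, one_ne_zero, rfl⟩ (crossings_bddAbove x n)

theorem one_le_vf (x : ℕ → ℂ) (n : ℕ) : 1 ≤ vf x n := by
  classical
  by_cases hn : n = 0
  · simp [vf, hn]
  · refine le_trans ?_ (crossings_le_vf one_ne_zero (x 0).re x n)
    unfold crossings
    refine Finset.one_le_card.mpr ⟨0, ?_⟩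
    simp only [Finset.mem_filter, Finset.mem_range]
    exact ⟨Nat.pos_of_ne_zero hn, Or.inr (Or.inl ⟨rfl, by simp [lineFun]⟩)⟩

variable {σ : Set ℂ}

/-- The curve variation of `f` on the list `[x 0, …, x n]`. -/
def cvar (f : σ → ℂ) (x : ℕ → σ) (n : ℕ) : ℝ≥0∞ :=
  ∑ i ∈ Finset.range n, ‖f (x (i + 1)) - f (x i)‖ₑ

/-- The two-dimensional variation of `f`: the supremum of `cvar / vf` over all nonempty finite
lists `[x 0, …, x n]` of points of `σ` (each list is written as an initial segment of a
sequence). -/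
def var (f : σ → ℂ) : ℝ≥0∞ :=
  ⨆ (x : ℕ → σ) (n : ℕ), cvar f x n / (vf (fun i => (x i : ℂ)) n : ℝ≥0∞)

/-- The supremum norm, possibly infinite. -/
def supNorm (f : σ → ℂ) : ℝ≥0∞ := ⨆ z : σ, ‖f z‖ₑ

/-- The variation norm `‖f‖_∞ + var(f, σ)`, possibly infinite. -/
def bvNorm (f : σ → ℂ) : ℝ≥0∞ := supNorm f + var f

theorem enorm_le_supNorm (f : σ → ℂ) (z : σ) : ‖f z‖ₑ ≤ supNorm f :=
  le_iSup (fun z : σ => ‖f z‖ₑ) z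

theorem cvar_div_le_var (f : σ → ℂ) (x : ℕ → σ) (n : ℕ) :
    cvar f x n / (vf (fun i => (x i : ℂ)) n : ℝ≥0∞) ≤ var f :=
  le_iSup₂ (f := fun (x : ℕ → σ) (n : ℕ) => cvar f x n / (vf (fun i => (x i : ℂ)) n : ℝ≥0∞)) x n

theorem bvNorm_algebraMap (r : ℂ) : bvNorm (algebraMap ℂ (σ → ℂ) r) ≤ ‖r‖ₑ := by
  have h1 : var (algebraMap ℂ (σ → ℂ) r) = 0 := by simp [var, cvar]
  have h2 : supNorm (algebraMap ℂ (σ → ℂ) r) ≤ ‖r‖ₑ := iSup_le fun z => by simp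
  simpa [bvNorm, h1] using h2

theorem bvNorm_add (f g : σ → ℂ) : bvNorm (f + g) ≤ bvNorm f + bvNorm g := by
  have h1 : supNorm (f + g) ≤ supNorm f + supNorm g := iSup_le fun z =>
    (enorm_add_le _ _).trans (add_le_add (enorm_le_supNorm f z) (enorm_le_supNorm g z))
  have h2 : var (f + g) ≤ var f + var g := iSup₂_le fun x n => by
    have h : cvar (f + g) x n ≤ cvar f x n + cvar g x n := by
      unfold cvar
      rw [← Finset.sum_add_distrib]
      refine Finset.sum_le_sum fun i _ => ?_
      refine le_trans (le_of_eq ?_) (enorm_add_le _ _)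
      congr 1
      simp only [Pi.add_apply]
      ring
    refine (ENNReal.div_le_div_right h _).trans ?_
    rw [ENNReal.add_div]
    exact add_le_add (cvar_div_le_var f x n) (cvar_div_le_var g x n)
  calc bvNorm (f + g) ≤ (supNorm f + supNorm g) + (var f + var g) := add_le_add h1 h2
    _ = bvNorm f + bvNorm g := by unfold bvNorm; ring

theorem bvNorm_mul (f g : σ → ℂ) : bvNorm (f * g) ≤ bvNorm f * bvNorm g := by
  have h1 : supNorm (f * g) ≤ supNorm f * supNorm g := iSup_le fun z => by
    rw [Pi.mul_apply, enorm_mul]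
    exact mul_le_mul' (enorm_le_supNorm f z) (enorm_le_supNorm g z)
  have h2 : var (f * g) ≤ supNorm f * var g + supNorm g * var f := iSup₂_le fun x n => by
    have h : cvar (f * g) x n ≤ supNorm f * cvar g x n + supNorm g * cvar f x n := by
      unfold cvar
      rw [Finset.mul_sum, Finset.mul_sum, ← Finset.sum_add_distrib]
      refine Finset.sum_le_sum fun i _ => ?_
      have e : (f * g) (x (i + 1)) - (f * g) (x i) =
          f (x (i + 1)) * (g (x (i + 1)) - g (x i)) + g (x i) * (f (x (i + 1)) - f (x i)) := by
        simp only [Pi.mul_apply]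
        ring
      rw [e]
      refine (enorm_add_le _ _).trans ?_
      rw [enorm_mul, enorm_mul]
      exact add_le_add (mul_le_mul_left (enorm_le_supNorm f _) _)
        (mul_le_mul_left (enorm_le_supNorm g _) _)
    refine (ENNReal.div_le_div_right h _).trans ?_
    rw [ENNReal.add_div, mul_div_assoc, mul_div_assoc]
    exact add_le_add (mul_le_mul_right (cvar_div_le_var g x n) _)
      (mul_le_mul_right (cvar_div_le_var f x n) _)
  calc bvNorm (f * g) ≤ supNorm f * supNorm g + (supNorm f * var g + supNorm g * var f) :=
        add_le_add h1 h2
    _ ≤ supNorm f * supNorm g + (supNorm f * var g + supNorm g * var f) + var f * var g :=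
        le_self_add
    _ = bvNorm f * bvNorm g := by unfold bvNorm; ring

theorem bvNorm_neg (f : σ → ℂ) : bvNorm (-f) = bvNorm f := by
  have h : ∀ (x : ℕ → σ) (i : ℕ),
      ‖(-f) (x (i + 1)) - (-f) (x i)‖ₑ = ‖f (x (i + 1)) - f (x i)‖ₑ := fun x i => by
    rw [← enorm_neg (f (x (i + 1)) - f (x i))]
    congr 1
    simp only [Pi.neg_apply]
    ring
  unfold bvNorm supNorm var cvar
  simp only [h]
  simp

variable (σ) in
/-- The functions of bounded variation on `σ`, as a subalgebra of all complex functions on `σ`. -/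
def bvSubalgebra : Subalgebra ℂ (σ → ℂ) where
  carrier := {f | bvNorm f < ∞}
  mul_mem' {f g} hf hg := (bvNorm_mul f g).trans_lt (ENNReal.mul_lt_top hf hg)
  add_mem' {f g} hf hg := (bvNorm_add f g).trans_lt (ENNReal.add_lt_top.mpr ⟨hf, hg⟩)
  algebraMap_mem' r := (bvNorm_algebraMap r).trans_lt enorm_lt_top

variable (σ) in
/-- The algebra `BV(σ)` with pointwise operations.  It is a type of its own so that it carries
the topology of the variation norm and not that of pointwise convergence. -/
def BV : Type := bvSubalgebra σ

instance : CommRing (BV σ) := inferInstanceAs (CommRing (bvSubalgebra σ))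

instance : Algebra ℂ (BV σ) := inferInstanceAs (Algebra ℂ (bvSubalgebra σ))

variable (σ) in
/-- The inclusion of `BV(σ)` in the algebra of all complex functions on `σ`. -/
def BV.val : BV σ →ₐ[ℂ] (σ → ℂ) := (bvSubalgebra σ).val

theorem BV.bvNorm_lt_top (f : BV σ) : bvNorm (BV.val σ f) < ∞ := f.2

theorem BV.val_injective : Function.Injective (BV.val σ) := Subtype.val_injective

variable (σ) in
/-- The variation norm on `BV(σ)`. -/
def bvRingNorm : RingNorm (BV σ) where
  toFun f := (bvNorm (BV.val σ f)).toReal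
  map_zero' := by
    have h := bvNorm_algebraMap (σ := σ) 0
    rw [map_zero, enorm_zero, nonpos_iff_eq_zero] at h
    rw [map_zero, h, ENNReal.toReal_zero]
  add_le' f g := by
    rw [map_add, ← ENNReal.toReal_add f.bvNorm_lt_top.ne g.bvNorm_lt_top.ne]
    exact ENNReal.toReal_mono (ENNReal.add_lt_top.mpr ⟨f.bvNorm_lt_top, g.bvNorm_lt_top⟩).ne
      (bvNorm_add _ _)
  neg' f := by rw [map_neg, bvNorm_neg]
  mul_le' f g := by
    rw [map_mul, ← ENNReal.toReal_mul]
    exact ENNReal.toReal_mono (ENNReal.mul_lt_top f.bvNorm_lt_top g.bvNorm_lt_top).ne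
      (bvNorm_mul _ _)
  eq_zero_of_map_eq_zero' f hf := by
    have h0 : bvNorm (BV.val σ f) = 0 :=
      ((ENNReal.toReal_eq_zero_iff _).mp hf).resolve_right f.bvNorm_lt_top.ne
    have h1 : supNorm (BV.val σ f) = 0 := (add_eq_zero.mp h0).1
    refine BV.val_injective ?_
    rw [map_zero]
    funext z
    have h2 := enorm_le_supNorm (BV.val σ f) z
    rw [h1, nonpos_iff_eq_zero, enorm_eq_zero] at h2
    exact h2

instance : NormedCommRing (BV σ) :=
  { (bvRingNorm σ).toNormedRing with mul_comm := mul_comm }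

theorem BV.norm_def (f : BV σ) : ‖f‖ = (bvNorm (BV.val σ f)).toReal := rfl

instance : NormedAlgebra ℂ (BV σ) where
  norm_smul_le r f := by
    have h : bvNorm (BV.val σ (r • f)) ≤ ‖r‖ₑ * bvNorm (BV.val σ f) := by
      rw [Algebra.smul_def, map_mul, AlgHom.commutes]
      exact (bvNorm_mul _ _).trans (mul_le_mul_left (bvNorm_algebraMap r) _)
    rw [BV.norm_def, BV.norm_def, ← toReal_enorm r, ← ENNReal.toReal_mul]
    exact ENNReal.toReal_mono (ENNReal.mul_lt_top enorm_lt_top f.bvNorm_lt_top).ne h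

variable (σ) in
/-- The restrictions to `σ` of the complex polynomials in the two real variables
`x = z.re`, `y = z.im`. -/
def polyFunctions : Subalgebra ℂ (σ → ℂ) :=
  (MvPolynomial.aeval (R := ℂ)
    ![fun z : σ => ((z : ℂ).re : ℂ), fun z : σ => ((z : ℂ).im : ℂ)]).range

/-- A bounded real coordinate `z ↦ u.re * z.re + u.im * z.im` has finite variation norm. -/
theorem bvNorm_coord_lt_top {u : ℂ} (hu : u ≠ 0) {M : ℝ}
    (hM : ∀ z ∈ σ, |lineFun u 0 z| ≤ M) :
    bvNorm (fun z : σ => ((lineFun u 0 z : ℝ) : ℂ)) < ∞ := by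
  classical
  have h1 : supNorm (fun z : σ => ((lineFun u 0 z : ℝ) : ℂ)) ≤ ENNReal.ofReal M :=
    iSup_le fun z => by
      rw [← ofReal_norm, Complex.norm_real, Real.norm_eq_abs]
      exact ENNReal.ofReal_le_ofReal (hM z z.2)
  have h2 : var (fun z : σ => ((lineFun u 0 z : ℝ) : ℂ)) ≤
      MeasureTheory.volume (Set.Icc (-M) M) := iSup₂_le fun x n => by
    set a : ℕ → ℝ := fun i => lineFun u 0 (x i) with ha
    set J : ℕ → Set ℝ := fun i => Set.Ioo (min (a i) (a (i + 1))) (max (a i) (a (i + 1))) with hJ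
    have haM : ∀ i, |a i| ≤ M := fun i => hM _ (x i).2
    have hc : cvar (fun z : σ => ((lineFun u 0 z : ℝ) : ℂ)) x n =
        ∫⁻ t, ∑ i ∈ Finset.range n, (J i).indicator (1 : ℝ → ℝ≥0∞) t := by
      rw [MeasureTheory.lintegral_finsetSum _
        (fun i _ => measurable_one.indicator measurableSet_Ioo)]
      refine Finset.sum_congr rfl fun i _ => ?_
      rw [MeasureTheory.lintegral_indicator_one measurableSet_Ioo, Real.volume_Ioo,
        ← ofReal_norm, ← Complex.ofReal_sub, Complex.norm_real, Real.norm_eq_abs,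
        max_sub_min_eq_abs]
    have hp : ∀ t, ∑ i ∈ Finset.range n, (J i).indicator (1 : ℝ → ℝ≥0∞) t ≤
        (Set.Icc (-M) M).indicator (fun _ => (vf (fun i => (x i : ℂ)) n : ℝ≥0∞)) t := fun t => by
      by_cases ht : t ∈ Set.Icc (-M) M
      · rw [Set.indicator_of_mem ht]
        have e : ∑ i ∈ Finset.range n, (J i).indicator (1 : ℝ → ℝ≥0∞) t =
            (((Finset.range n).filter (fun i => t ∈ J i)).card : ℝ≥0∞) := by
          rw [Finset.natCast_card_filter]
          refine Finset.sum_congr rfl fun i _ => ?_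
          by_cases hi : t ∈ J i <;> simp [hi]
        rw [e]
        refine Nat.cast_le.mpr (le_trans ?_ (crossings_le_vf hu t (fun i => (x i : ℂ)) n))
        unfold crossings
        refine Finset.card_le_card (Finset.monotone_filter_right _ fun i _ hi => Or.inl ?_)
        have e1 : ∀ j, lineFun u t (x j) = a j - t := fun j => by simp [ha, lineFun]
        simp only [e1]
        obtain ⟨l, r⟩ := hi
        rcases le_total (a i) (a (i + 1)) with h | h
        · rw [min_eq_left h] at l
          rw [max_eq_right h] at r
          exact mul_neg_of_neg_of_pos (by linarith) (by linarith)
        · rw [min_eq_right h] at l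
          rw [max_eq_left h] at r
          exact mul_neg_of_pos_of_neg (by linarith) (by linarith)
      · rw [Set.indicator_of_notMem ht]
        refine le_of_eq (Finset.sum_eq_zero fun i _ => Set.indicator_of_notMem (fun hi => ht ?_) _)
        have b1 := abs_le.mp (haM i)
        have b2 := abs_le.mp (haM (i + 1))
        exact ⟨(le_min b1.1 b2.1).trans hi.1.le, hi.2.le.trans (max_le b1.2 b2.2)⟩
    refine ENNReal.div_le_of_le_mul ?_
    rw [hc]
    refine (MeasureTheory.lintegral_mono hp).trans (le_of_eq ?_)
    rw [MeasureTheory.lintegral_indicator_const measurableSet_Icc, mul_comm]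
  refine ENNReal.add_lt_top.mpr ⟨h1.trans_lt ENNReal.ofReal_lt_top, h2.trans_lt ?_⟩
  rw [Real.volume_Icc]
  exact ENNReal.ofReal_lt_top

/-- On a bounded set the polynomial functions belong to `BV(σ)`, so that pulling `polyFunctions σ`
back to `BV(σ)` in the definition of `AC σ` loses nothing. -/
theorem polyFunctions_le_bvSubalgebra (hσ : Bornology.IsBounded σ) :
    polyFunctions σ ≤ bvSubalgebra σ := by
  obtain ⟨M, hM⟩ := hσ.exists_norm_le
  rw [polyFunctions, ← Algebra.adjoin_range_eq_range_aeval, Algebra.adjoin_le_iff]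
  rintro f ⟨i, rfl⟩
  fin_cases i
  · have := bvNorm_coord_lt_top (σ := σ) (u := 1) one_ne_zero (M := M) fun z hz => by
      simpa [lineFun] using (Complex.abs_re_le_norm z).trans (hM z hz)
    simpa [bvSubalgebra, lineFun] using this
  · have := bvNorm_coord_lt_top (σ := σ) (u := Complex.I) Complex.I_ne_zero (M := M) fun z hz => by
      simpa [lineFun] using (Complex.abs_im_le_norm z).trans (hM z hz)
    simpa [bvSubalgebra, lineFun] using this

variable (σ) in
/-- The Banach algebra `AC(σ)`: the closure in `BV(σ)`, for the variation norm, of the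
polynomial functions. -/
def AC : Subalgebra ℂ (BV σ) := ((polyFunctions σ).comap (BV.val σ)).topologicalClosure

end ACSpace

end

/-! A homeomorphism of linear graphs need not preserve bounded variation, so it is used only for its
combinatorics. After enough vertices are added on both sides it matches vertices with vertices and
edges with edges, and it can then be replaced by a bijection `k` that is affine on every edge
(`IsGraph.exists_isCellAffine`). Composition with `k` and with its inverse gives the isomorphism,
for two reasons.

First, composition with `k` is bounded in the variation norm (`IsCellDecomp.var_comp_le`). A step of
a list within one cell is controlled by the variation along that cell. A step between two cells,
with neither end in the other cell, crosses a line that depends only on the pair of cells, so the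
number of such steps is at most `vf`.

Second, composition with `k` sends polynomials into `AC` (`precomp_mem_acFun`), because every
cellwise polynomial function lies in `AC(σ)` (`IsCellDecomp.mem_acFun`). Subtracting an
interpolating polynomial makes the function vanish at all vertices; what remains on each cell is a
polynomial times a bump concentrated on that cell. The bump is a product of four square roots of
affine functions, and these lie in `AC(σ)` because absolutely continuous functions of one real
coordinate do (`acFun_comp_lineFun`). Closedness of `AC` does the rest.

Conversely, an isomorphism pulls evaluations back to continuous characters, and every continuous
character is an evaluation (`exists_eval_eq_character`). The Leibniz rule shows that the norm of a
power grows like the power of the supremum norm up to a linear factor, so characters are bounded by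
the supremum norm. This makes them real on real functions and locates the image of the two
coordinates in `σ`. The resulting point maps for the isomorphism and its inverse are continuous and
mutually inverse. -/

namespace ACSpace

open MeasureTheory Set

/-! ### Absolutely continuous functions of one real coordinate. -/

section OneVariable

variable {σ : Set ℂ}

/-- The functions on `σ` that belong to `AC(σ)`. -/
noncomputable def acFun (σ : Set ℂ) : Subalgebra ℂ (σ → ℂ) := (AC σ).map (BV.val σ)

theorem exists_val_eq {f : σ → ℂ} (hf : bvNorm f < ∞) : ∃ F : BV σ, BV.val σ F = f :=
  ⟨⟨f, hf⟩, rfl⟩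

theorem polyFunctions_le_acFun (hσ : Bornology.IsBounded σ) : polyFunctions σ ≤ acFun σ := by
  intro f hf
  obtain ⟨F, rfl⟩ := exists_val_eq (polyFunctions_le_bvSubalgebra hσ hf)
  exact ⟨F, Subalgebra.le_topologicalClosure _ hf, rfl⟩

theorem mem_acFun_of_approx (hσ : Bornology.IsBounded σ) {f : σ → ℂ}
    (h : ∀ ε : ℝ, 0 < ε → ∃ p ∈ polyFunctions σ, bvNorm (f - p) ≤ ENNReal.ofReal ε) :
    f ∈ acFun σ := by
  have hf : bvNorm f < ∞ := by
    obtain ⟨p, hp, hfp⟩ := h 1 one_pos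
    have := bvNorm_add (f - p) p
    rw [sub_add_cancel] at this
    exact this.trans_lt (ENNReal.add_lt_top.mpr
      ⟨hfp.trans_lt ENNReal.ofReal_lt_top, polyFunctions_le_bvSubalgebra hσ hp⟩)
  obtain ⟨F, rfl⟩ := exists_val_eq hf
  refine ⟨F, ?_, rfl⟩
  change F ∈ closure (((polyFunctions σ).comap (BV.val σ) : Subalgebra ℂ (BV σ)) : Set (BV σ))
  refine Metric.mem_closure_iff.mpr fun ε hε => ?_
  obtain ⟨p, hp, hfp⟩ := h (ε / 2) (half_pos hε)
  obtain ⟨P, rfl⟩ := exists_val_eq (polyFunctions_le_bvSubalgebra hσ hp)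
  refine ⟨P, hp, ?_⟩
  rw [dist_eq_norm, BV.norm_def, map_sub]
  exact (ENNReal.toReal_le_of_le_ofReal (half_pos hε).le hfp).trans_lt (half_lt_self hε)

/-- A polynomial in the real coordinate `lineFun u c` is a polynomial function. -/
theorem polynomial_lineFun_mem (q : Polynomial ℂ) (u : ℂ) (c : ℝ) :
    (fun z : σ => q.eval ((lineFun u c z : ℝ) : ℂ)) ∈ polyFunctions σ := by
  have hx : (fun z : σ => ((z : ℂ).re : ℂ)) ∈ polyFunctions σ :=
    ⟨MvPolynomial.X 0, by simp⟩
  have hy : (fun z : σ => ((z : ℂ).im : ℂ)) ∈ polyFunctions σ :=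
    ⟨MvPolynomial.X 1, by simp⟩
  have hl : (fun z : σ => ((lineFun u c z : ℝ) : ℂ)) ∈ polyFunctions σ := by
    have : (fun z : σ => ((lineFun u c z : ℝ) : ℂ)) =
        (u.re : ℂ) • (fun z : σ => ((z : ℂ).re : ℂ)) + (u.im : ℂ) • (fun z : σ => ((z : ℂ).im : ℂ))
          - algebraMap ℂ (σ → ℂ) c := by
      funext z
      simp [lineFun]
    rw [this]
    exact sub_mem (add_mem (Subalgebra.smul_mem _ hx _) (Subalgebra.smul_mem _ hy _))
      (Subalgebra.algebraMap_mem _ _)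
  have : (fun z : σ => q.eval ((lineFun u c z : ℝ) : ℂ)) =
      Polynomial.aeval (fun z : σ => ((lineFun u c z : ℝ) : ℂ)) q := by
    funext z
    induction q using Polynomial.induction_on' with
    | add p q hp hq => simp_all
    | monomial n a => simp [Polynomial.aeval_monomial]
  rw [this]
  exact Algebra.adjoin_le (singleton_subset_iff.mpr hl)
    (Polynomial.aeval_mem_adjoin_singleton _ _)

/-- Monotone functions of a real coordinate have variation controlled by the variation factor. -/
theorem sum_enorm_sub_le_vf {u : ℂ} (hu : u ≠ 0) (c : ℝ) (x : ℕ → ℂ) (n : ℕ) {F : ℝ → ℝ}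
    (hF : Monotone F) {C : ℝ} (h0 : ∀ t, 0 ≤ F t) (hC : ∀ t, F t ≤ C) :
    ∑ i ∈ Finset.range n, ‖F (lineFun u c (x (i + 1))) - F (lineFun u c (x i))‖ₑ ≤
      vf x n * ENNReal.ofReal C := by
  classical
  set a : ℕ → ℝ := fun i => lineFun u c (x i) with ha
  set J : ℕ → Set ℝ := fun i => Ioo (min (F (a i)) (F (a (i + 1)))) (max (F (a i)) (F (a (i + 1))))
    with hJ
  have hc : ∑ i ∈ Finset.range n, ‖F (a (i + 1)) - F (a i)‖ₑ =
      ∫⁻ t, ∑ i ∈ Finset.range n, (J i).indicator (1 : ℝ → ℝ≥0∞) t := by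
    rw [lintegral_finsetSum _ (fun i _ => measurable_one.indicator measurableSet_Ioo)]
    refine Finset.sum_congr rfl fun i _ => ?_
    rw [lintegral_indicator_one measurableSet_Ioo, Real.volume_Ioo,
      ← ofReal_norm, Real.norm_eq_abs, max_sub_min_eq_abs]
  have hp : ∀ t, ∑ i ∈ Finset.range n, (J i).indicator (1 : ℝ → ℝ≥0∞) t ≤
      (Icc 0 C).indicator (fun _ => (vf x n : ℝ≥0∞)) t := fun r => by
    by_cases hr : r ∈ Icc 0 C
    · rw [indicator_of_mem hr]
      have e : ∑ i ∈ Finset.range n, (J i).indicator (1 : ℝ → ℝ≥0∞) r =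
          (((Finset.range n).filter (fun i => r ∈ J i)).card : ℝ≥0∞) := by
        rw [Finset.natCast_card_filter]
        refine Finset.sum_congr rfl fun i _ => ?_
        by_cases hi : r ∈ J i <;> simp [hi]
      rw [e]
      -- The variation is the integral over levels `r` of the number of steps passing `r`. Since `F`
      -- is monotone, the finitely many parameters with value below `r` precede those with value
      -- above `r`. One line strictly between the two groups is crossed by every such step;
      -- continuity of `F` plays no role.
      let A := (Finset.range (n + 1)).image a
      obtain ⟨m, hlo, hhi⟩ := Order.exists_between_finsets (A.filter fun s => F s < r)
        (A.filter fun s => r < F s) fun s hs t ht => by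
          by_contra! hts
          linarith [hF hts, (Finset.mem_filter.mp hs).2, (Finset.mem_filter.mp ht).2]
      refine Nat.cast_le.mpr (le_trans ?_ (crossings_le_vf hu (c + m) x n))
      unfold crossings
      refine Finset.card_le_card fun i hi => ?_
      obtain ⟨hin, hi⟩ := Finset.mem_filter.mp hi
      refine Finset.mem_filter.mpr ⟨hin, Or.inl ?_⟩
      have e1 : ∀ j, lineFun u (c + m) (x j) = a j - m := fun j => by
        simp only [ha, lineFun]; ring
      have hin := Finset.mem_range.mp hin
      have m0 : a i ∈ A := Finset.mem_image_of_mem _ (by simp; omega)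
      have m1 : a (i + 1) ∈ A := Finset.mem_image_of_mem _ (by simp; omega)
      simp only [e1]
      obtain ⟨l, r'⟩ := hi
      rcases le_total (F (a i)) (F (a (i + 1))) with h | h
      · rw [min_eq_left h] at l
        rw [max_eq_right h] at r'
        exact mul_neg_of_neg_of_pos
          (by linarith [hlo _ (Finset.mem_filter.mpr ⟨m0, l⟩)])
          (by linarith [hhi _ (Finset.mem_filter.mpr ⟨m1, r'⟩)])
      · rw [min_eq_right h] at l
        rw [max_eq_left h] at r'
        exact mul_neg_of_pos_of_neg
          (by linarith [hhi _ (Finset.mem_filter.mpr ⟨m0, r'⟩)])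
          (by linarith [hlo _ (Finset.mem_filter.mpr ⟨m1, l⟩)])
    · rw [indicator_of_notMem hr]
      refine le_of_eq (Finset.sum_eq_zero fun i _ => indicator_of_notMem (fun hi => hr ?_) _)
      exact ⟨(le_min (h0 _) (h0 _)).trans hi.1.le, hi.2.le.trans (max_le (hC _) (hC _))⟩
  rw [hc]
  refine (lintegral_mono hp).trans (le_of_eq ?_)
  rw [lintegral_indicator_const measurableSet_Icc, Real.volume_Icc, sub_zero]

theorem var_le_of_norm_sub_le {u : ℂ} (hu : u ≠ 0) (c : ℝ) {f : σ → ℂ} {F : ℝ → ℝ}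
    (hF : Monotone F) {C : ℝ} (h0 : ∀ t, 0 ≤ F t) (hC : ∀ t, F t ≤ C)
    (h : ∀ z w : σ, ‖f z - f w‖ ≤ |F (lineFun u c z) - F (lineFun u c w)|) :
    var f ≤ ENNReal.ofReal C := by
  refine iSup₂_le fun x n => ENNReal.div_le_of_le_mul' ?_
  refine le_trans ?_ (sum_enorm_sub_le_vf hu c (fun i => (x i : ℂ)) n hF h0 hC)
  refine Finset.sum_le_sum fun i _ => ?_
  rw [← ofReal_norm, ← ofReal_norm]
  exact ENNReal.ofReal_le_ofReal (h _ _)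

theorem exists_derivative_eq (r : Polynomial ℝ) :
    ∃ q : Polynomial ℝ, Polynomial.derivative q = r := by
  induction r using Polynomial.induction_on' with
  | add p q hp hq =>
    obtain ⟨p', rfl⟩ := hp
    obtain ⟨q', rfl⟩ := hq
    exact ⟨p' + q', by simp⟩
  | monomial n a =>
    refine ⟨Polynomial.monomial (n + 1) (a / (n + 1)), ?_⟩
    rw [Polynomial.derivative_monomial]
    have : (n : ℝ) + 1 ≠ 0 := by positivity
    simp [div_mul_cancel₀ _ this]

/-- Polynomials are dense in `L¹` of a bounded interval. -/
theorem exists_polynomial_integral_sub_le {A B : ℝ} {φ : ℝ → ℝ}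
    (hAB : A ≤ B) (hφ : IntervalIntegrable φ volume A B) {ε : ℝ} (hε : 0 < ε) :
    ∃ r : Polynomial ℝ, ∫ s in A..B, |φ s - r.eval s| ≤ ε := by
  have hint : Integrable ((Ioc A B).indicator φ) :=
    ((intervalIntegrable_iff_integrableOn_Ioc_of_le hAB).mp hφ).integrable_indicator
      measurableSet_Ioc
  obtain ⟨g, -, hg, hgc, hgi⟩ := hint.exists_hasCompactSupport_integral_sub_le (half_pos hε)
  -- The `+ 1` keeps the denominator positive when the interval is a single point.
  have hpos : 0 < ε / 2 / (B - A + 1) := by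
    have : 0 < B - A + 1 := by linarith
    positivity
  obtain ⟨r, hr⟩ := exists_polynomial_near_of_continuousOn A B g hgc.continuousOn _ hpos
  refine ⟨r, ?_⟩
  have i1 : IntervalIntegrable (fun s => |φ s - g s|) volume A B :=
    (hφ.sub (hgc.intervalIntegrable _ _)).abs
  have i2 : IntervalIntegrable (fun s => |g s - r.eval s|) volume A B :=
    (hgc.sub r.continuous).abs.intervalIntegrable _ _
  have hle : ∫ s in A..B, |φ s - r.eval s| ≤ ∫ s in A..B, (|φ s - g s| + |g s - r.eval s|) := by
    refine intervalIntegral.integral_mono_on hAB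
      (hφ.sub (r.continuous.intervalIntegrable _ _)).abs (i1.add i2) fun s _ => abs_sub_le _ _ _
  refine hle.trans ?_
  rw [intervalIntegral.integral_add i1 i2]
  have b1 : ∫ s in A..B, |φ s - g s| ≤ ε / 2 := by
    refine le_trans ?_ hg
    rw [intervalIntegral.integral_of_le hAB, ← integral_indicator measurableSet_Ioc]
    refine integral_mono_of_nonneg (Filter.Eventually.of_forall fun s =>
      indicator_nonneg (fun _ _ => abs_nonneg _) s) (hint.sub hgi).norm
      (Filter.Eventually.of_forall fun s => ?_)
    by_cases hs : s ∈ Ioc A B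
    · simp [hs]
    · simp [hs]
  have b2 : ∫ s in A..B, |g s - r.eval s| ≤ ε / 2 := by
    have : ∫ s in A..B, |g s - r.eval s| ≤ ∫ s in A..B, ε / 2 / (B - A + 1) :=
      intervalIntegral.integral_mono_on hAB i2 (by simp) fun s hs => by
        rw [abs_sub_comm]; exact (hr s hs).le
    refine this.trans ?_
    rw [intervalIntegral.integral_const, smul_eq_mul, mul_div_assoc',
      div_le_iff₀ (by linarith)]
    nlinarith
  linarith

/-- Absolutely continuous functions of a real coordinate belong to `AC(σ)`. -/
theorem acFun_comp_lineFun (hσ : Bornology.IsBounded σ) {u : ℂ} (hu : u ≠ 0) (c : ℝ)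
    {G φ : ℝ → ℝ} (hφ : ∀ s t, IntervalIntegrable φ volume s t)
    (hG : ∀ s t, ∫ r in s..t, φ r = G t - G s) :
    (fun z : σ => ((G (lineFun u c z) : ℝ) : ℂ)) ∈ acFun σ := by
  obtain ⟨M, hM0, hM⟩ : ∃ M : ℝ, 0 ≤ M ∧ ∀ z ∈ σ, |lineFun u c z| ≤ M := by
    obtain ⟨R, hR⟩ := hσ.exists_norm_le
    refine ⟨|u.re| * |R| + |u.im| * |R| + |c|, by positivity, fun z hz => ?_⟩
    have h1 := (Complex.abs_re_le_norm z).trans ((hR z hz).trans (le_abs_self R))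
    have h2 := (Complex.abs_im_le_norm z).trans ((hR z hz).trans (le_abs_self R))
    unfold lineFun
    refine (abs_sub _ _).trans (add_le_add ((abs_add_le _ _).trans ?_) le_rfl)
    rw [abs_mul, abs_mul]
    gcongr
  refine mem_acFun_of_approx hσ fun ε hε => ?_
  obtain ⟨r, hr⟩ := exists_polynomial_integral_sub_le (A := -M) (B := M) (by linarith)
    (hφ (-M) M) (half_pos hε)
  obtain ⟨q, hq⟩ := exists_derivative_eq r
  -- The error of approximating `G` by an antiderivative of `r`, normalised to vanish at `-M` so
  -- that its supremum is bounded by its variation.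
  let D : ℝ → ℝ := fun t => G t - q.eval t - (G (-M) - q.eval (-M))
  let ψ : ℝ → ℝ := fun s => φ s - r.eval s
  have hψ : ∀ s t, IntervalIntegrable ψ volume s t := fun s t =>
    (hφ s t).sub (r.continuous.intervalIntegrable _ _)
  have hD : ∀ s t, D t - D s = ∫ x in s..t, ψ x := fun s t => by
    have : ∫ x in s..t, r.eval x = q.eval t - q.eval s :=
      intervalIntegral.integral_eq_sub_of_hasDerivAt (fun x _ => by
        rw [← hq]; exact q.hasDerivAt x) (r.continuous.intervalIntegrable _ _)
    simp only [ψ]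
    rw [intervalIntegral.integral_sub (hφ s t) (r.continuous.intervalIntegrable _ _), this, hG]
    simp only [D]
    ring
  let Ψ : ℝ → ℝ := (Icc (-M) M).indicator fun s => |ψ s|
  have hΨ0 : ∀ s, 0 ≤ Ψ s := fun s => indicator_nonneg (fun _ _ => abs_nonneg _) s
  have hΨ : Integrable Ψ := ((intervalIntegrable_iff_integrableOn_Icc_of_le (by linarith)).mp
    (hψ (-M) M).abs).integrable_indicator measurableSet_Icc
  have hΨi : ∫ s, Ψ s ≤ ε / 2 := by
    rw [integral_indicator measurableSet_Icc, integral_Icc_eq_integral_Ioc,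
      ← intervalIntegral.integral_of_le (by linarith)]
    exact hr
  -- The cumulative variation of `D`. Cutting `ψ` off outside `[-M, M]` makes `F` monotone with
  -- values in `[0, ε/2]` on the whole line, as the variation bound requires.
  let F : ℝ → ℝ := fun t => ∫ s in Iic t, Ψ s
  have hF : Monotone F := fun s t hst =>
    setIntegral_mono_set hΨ.integrableOn (Filter.Eventually.of_forall hΨ0)
      (Iic_subset_Iic.mpr hst).eventuallyLE
  have hF0 : ∀ t, 0 ≤ F t := fun t => integral_nonneg hΨ0
  have hFC : ∀ t, F t ≤ ε / 2 := fun t =>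
    (setIntegral_le_integral hΨ (Filter.Eventually.of_forall hΨ0)).trans hΨi
  have hDF : ∀ s ∈ Icc (-M) M, ∀ t ∈ Icc (-M) M, |D t - D s| ≤ |F t - F s| := by
    intro s hs t ht
    have : F t - F s = ∫ x in s..t, |ψ x| := by
      rw [intervalIntegral.integral_Iic_sub_Iic hΨ.integrableOn hΨ.integrableOn]
      refine intervalIntegral.integral_congr fun x hx => indicator_of_mem ?_ _
      exact (uIcc_subset_Icc hs ht) hx
    rw [this, hD]
    simpa only [Real.norm_eq_abs] using
      intervalIntegral.norm_integral_le_abs_integral_norm (f := ψ) (a := s) (b := t)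
        (μ := volume)
  have hmem : ∀ z : σ, lineFun u c z ∈ Icc (-M) M := fun z => abs_le.mp (hM z z.2)
  refine ⟨fun z => ((q.map Complex.ofRealHom + Polynomial.C
    ((G (-M) - q.eval (-M) : ℝ) : ℂ)).eval ((lineFun u c z : ℝ) : ℂ)),
    polynomial_lineFun_mem _ u c, ?_⟩
  have hfun : ((fun z : σ => ((G (lineFun u c z) : ℝ) : ℂ)) - fun z : σ =>
      ((q.map Complex.ofRealHom + Polynomial.C
        ((G (-M) - q.eval (-M) : ℝ) : ℂ)).eval ((lineFun u c z : ℝ) : ℂ))) =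
      fun z : σ => ((D (lineFun u c z) : ℝ) : ℂ) := by
    funext z
    have : (q.map Complex.ofRealHom).eval ((lineFun u c z : ℝ) : ℂ) =
        ((q.eval (lineFun u c z) : ℝ) : ℂ) := by
      rw [Polynomial.eval_map]
      exact Polynomial.eval₂_at_apply Complex.ofRealHom _
    simp only [Pi.sub_apply, Polynomial.eval_add, this, Polynomial.eval_C, D]
    push_cast
    ring
  rw [hfun]
  have h1 : supNorm (fun z : σ => ((D (lineFun u c z) : ℝ) : ℂ)) ≤ ENNReal.ofReal (ε / 2) := by
    refine iSup_le fun z => ?_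
    rw [← ofReal_norm, Complex.norm_real]
    refine ENNReal.ofReal_le_ofReal ?_
    have := hDF (-M) ⟨le_rfl, by linarith⟩ _ (hmem z)
    have hD0 : D (-M) = 0 := by simp [D]
    rw [hD0, sub_zero] at this
    refine this.trans ?_
    rw [abs_of_nonneg (sub_nonneg.mpr (hF (hmem z).1))]
    linarith [hF0 (-M), hFC (lineFun u c z)]
  have h2 : var (fun z : σ => ((D (lineFun u c z) : ℝ) : ℂ)) ≤ ENNReal.ofReal (ε / 2) :=
    var_le_of_norm_sub_le hu c hF hF0 hFC fun z w => by
      rw [← Complex.ofReal_sub, Complex.norm_real]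
      exact hDF _ (hmem w) _ (hmem z)
  refine (add_le_add h1 h2).trans ?_
  rw [← ENNReal.ofReal_add (half_pos hε).le (half_pos hε).le, add_halves]

/-- The derivative of the square root has an integrable singularity at 0. Square roots are preferred
to positive parts because a product of two of them can restrict to a linear function on a segment
and still vanish on a half-plane; this gives bumps with simple zeros at the ends. -/
theorem sqrt_lineFun_mem_acFun (hσ : Bornology.IsBounded σ) {u : ℂ} (hu : u ≠ 0) (c : ℝ) :
    (fun z : σ => ((√(lineFun u c z) : ℝ) : ℂ)) ∈ acFun σ := by
  have hi : ∀ t, IntervalIntegrable (fun s => 1 / (2 * √s)) volume 0 t := fun t => by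
    rcases le_total 0 t with ht | ht
    · refine intervalIntegral.intervalIntegrable_deriv_of_nonneg
        Real.continuous_sqrt.continuousOn (fun x hx => ?_) fun x _ => by positivity
      rw [min_eq_left ht] at hx
      exact Real.hasDerivAt_sqrt hx.1.ne'
    -- For nonpositive arguments `√x` is 0, and division by zero gives 0, so the integrand vanishes
    -- there.
    · refine (intervalIntegrable_const (c := (0 : ℝ))).congr fun x hx => ?_
      rw [uIoc_of_ge ht] at hx
      simp [Real.sqrt_eq_zero_of_nonpos hx.2]
  have hi' : ∀ s t, IntervalIntegrable (fun s => 1 / (2 * √s)) volume s t := fun s t =>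
    (hi s).symm.trans (hi t)
  refine acFun_comp_lineFun hσ hu c hi' fun s t => ?_
  refine integral_eq_of_hasDerivAt_off_countable _ _ (countable_singleton 0)
    Real.continuous_sqrt.continuousOn (fun x hx => ?_) (hi' s t)
  exact Real.hasDerivAt_sqrt hx.2

end OneVariable

/-! ### Cell decompositions and cellwise polynomial functions. -/

section Cells

variable {κ : Type*} {σ : Set ℂ} {a b : κ → ℂ}

/-- The closed segments `[a i, b i]`, some of which may be single points, cover `σ`, and the
relative interior of every nondegenerate one is disjoint from all others. -/
structure IsCellDecomp (σ : Set ℂ) (a b : κ → ℂ) : Prop where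
  cover : σ = ⋃ i, segment ℝ (a i) (b i)
  disj : ∀ i j, i ≠ j → a i ≠ b i →
    Disjoint (openSegment ℝ (a i) (b i)) (segment ℝ (a j) (b j))

theorem mem_segment_iff_lineMap {p q z : ℂ} :
    z ∈ segment ℝ p q ↔ ∃ t ∈ Icc (0 : ℝ) 1, z = AffineMap.lineMap p q t := by
  rw [segment_eq_image_lineMap]
  exact ⟨fun ⟨t, h, e⟩ => ⟨t, h, e.symm⟩, fun ⟨t, h, e⟩ => ⟨t, h, e.symm⟩⟩

theorem mem_openSegment_iff_lineMap {p q z : ℂ} :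
    z ∈ openSegment ℝ p q ↔ ∃ t ∈ Ioo (0 : ℝ) 1, z = AffineMap.lineMap p q t := by
  rw [openSegment_eq_image_lineMap]
  exact ⟨fun ⟨t, h, e⟩ => ⟨t, h, e.symm⟩, fun ⟨t, h, e⟩ => ⟨t, h, e.symm⟩⟩

theorem lineMap_eq_add (p q : ℂ) (t : ℝ) :
    (AffineMap.lineMap p q t : ℂ) = p + t * (q - p) := by
  rw [AffineMap.lineMap_apply]
  simp [add_comm]

theorem lineMap_sub_div {p q : ℂ} (h : p ≠ q) (t : ℝ) :
    ((AffineMap.lineMap p q t : ℂ) - p) / (q - p) = t := by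
  have : q - p ≠ 0 := sub_ne_zero.mpr h.symm
  rw [lineMap_eq_add, add_sub_cancel_left, mul_div_cancel_right₀ _ this]

theorem left_notMem_openSegment {p q : ℂ} (h : p ≠ q) : p ∉ openSegment ℝ p q := fun hp =>
  h (left_mem_openSegment_iff.mp hp)

theorem right_notMem_openSegment {p q : ℂ} (h : p ≠ q) : q ∉ openSegment ℝ p q := fun hp =>
  h (right_mem_openSegment_iff.mp hp)

theorem mem_openSegment_or_eq {p q z : ℂ} (hz : z ∈ segment ℝ p q) :
    z = p ∨ z = q ∨ z ∈ openSegment ℝ p q := by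
  by_cases h1 : z = p
  · exact Or.inl h1
  by_cases h2 : z = q
  · exact Or.inr (Or.inl h2)
  exact Or.inr (Or.inr (mem_openSegment_of_ne_left_right (Ne.symm h1) (Ne.symm h2) hz))

/-- A segment that avoids the open unit interval of the real axis avoids a thin rhombus around
it. -/
theorem exists_thin_rhombus {C D : ℂ}
    (h : ∀ w ∈ segment ℝ C D, w.im = 0 → w.re ≤ 0 ∨ 1 ≤ w.re) :
    ∃ ε : ℝ, 0 < ε ∧ ∀ w ∈ segment ℝ C D, ε * w.re ≤ |w.im| ∨ ε * (1 - w.re) ≤ |w.im| := by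
  by_cases h0 : ∃ w ∈ segment ℝ C D, w.im = 0
  · obtain ⟨w₀, hw₀, him⟩ := h0
    by_cases hCD : C.im = D.im
    · refine ⟨1, one_pos, fun w hw => ?_⟩
      obtain ⟨t, -, rfl⟩ := mem_segment_iff_lineMap.mp hw
      obtain ⟨t₀, -, rfl⟩ := mem_segment_iff_lineMap.mp hw₀
      have e : (AffineMap.lineMap C D t : ℂ).im = 0 := by
        rw [lineMap_eq_add] at him ⊢
        simp only [Complex.add_im, Complex.mul_im, Complex.ofReal_re, Complex.ofReal_im,
          Complex.sub_im, hCD] at him ⊢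
        linarith
      rcases h _ hw e with h1 | h1
      · left; rw [e, abs_zero]; linarith
      · right; rw [e, abs_zero]; linarith
    · have hpos : 0 < |D.im - C.im| := abs_pos.mpr (sub_ne_zero.mpr (Ne.symm hCD))
      have hpos' : 0 < |D.re - C.re| + 1 := by positivity
      -- The slope of the segment bounds the opening angle at its point on the axis, which lies
      -- outside the open unit interval. The `+ 1` covers vertical segments.
      refine ⟨|D.im - C.im| / (|D.re - C.re| + 1), by positivity, fun w hw => ?_⟩
      have hbd : ∀ r : ℝ, |D.im - C.im| / (|D.re - C.re| + 1) * (r * (D.re - C.re)) ≤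
          |r * (D.im - C.im)| := fun r => by
        rw [div_mul_eq_mul_div, div_le_iff₀ hpos', abs_mul]
        have : r * (D.re - C.re) ≤ |r| * |D.re - C.re| := by
          rw [← abs_mul]; exact le_abs_self _
        nlinarith [abs_nonneg r, mul_nonneg (abs_nonneg r) hpos.le]
      obtain ⟨t, -, rfl⟩ := mem_segment_iff_lineMap.mp hw
      obtain ⟨t₀, -, rfl⟩ := mem_segment_iff_lineMap.mp hw₀
      have hc := h _ hw₀ him
      rw [lineMap_eq_add] at him hc ⊢
      simp only [Complex.add_im, Complex.mul_im, Complex.ofReal_re, Complex.ofReal_im,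
          Complex.sub_im, zero_mul, Complex.add_re, Complex.mul_re, Complex.sub_re,
          add_zero, sub_zero] at him hc ⊢
      have e : C.im + t * (D.im - C.im) = (t - t₀) * (D.im - C.im) := by linear_combination him
      rw [e]
      have hK : 0 < |D.im - C.im| / (|D.re - C.re| + 1) := by positivity
      rcases hc with h1 | h1
      · left
        refine le_trans (mul_le_mul_of_nonneg_left ?_ hK.le) (hbd (t - t₀))
        linarith
      · right
        have := hbd (-(t - t₀))
        rw [neg_mul (t - t₀) (D.im - C.im), abs_neg] at this
        refine le_trans (mul_le_mul_of_nonneg_left ?_ hK.le) this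
        linarith
  · push Not at h0
    have hcpt : IsCompact (segment ℝ C D) := by
      rw [segment_eq_image_lineMap]
      exact isCompact_Icc.image AffineMap.lineMap_continuous
    obtain ⟨w₀, hw₀, hmin⟩ := hcpt.exists_isMinOn ⟨C, left_mem_segment ℝ C D⟩
      (Complex.continuous_im.abs.continuousOn)
    have hpos : 0 < |w₀.im| := abs_pos.mpr (h0 _ hw₀)
    -- A segment that misses the axis keeps a positive distance from it by compactness.
    refine ⟨|w₀.im|, hpos, fun w hw => ?_⟩
    have hle : |w₀.im| ≤ |w.im| := hmin hw
    rcases le_total w.re 1 with h1 | h1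
    · left; nlinarith
    · right; nlinarith [abs_nonneg w.im]

theorem lineFun_conj (p : ℂ) (q : ℝ) (z : ℂ) :
    lineFun (starRingEnd ℂ p) (-q) z = (p * z).re + q := by
  simp [lineFun, sub_eq_add_neg]

theorem sqrt_re_mem_acFun (hσ : Bornology.IsBounded σ) {p v : ℂ} (hp : p ≠ 0) (hv : v ≠ 0)
    (w : ℂ) (q : ℝ) :
    (fun z : σ => ((√((p * ((z - w) / v)).re + q) : ℝ) : ℂ)) ∈ acFun σ := by
  have hne : starRingEnd ℂ (p / v) ≠ 0 := (map_ne_zero _).mpr (div_ne_zero hp hv)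
  have := sqrt_lineFun_mem_acFun hσ hne (-(q - (p * (w / v)).re))
  simp only [lineFun_conj] at this
  refine (congrArg (· ∈ acFun σ) (funext fun z => ?_)).mp this
  have : p * ((z - w) / v) = p / v * z - p * (w / v) := by field_simp
  rw [this, Complex.sub_re]
  congr 2
  ring

theorem polynomial_re_mem (q : Polynomial ℂ) (v w : ℂ) :
    (fun z : σ => q.eval ((((z - w) / v).re : ℝ) : ℂ)) ∈ polyFunctions σ := by
  have := polynomial_lineFun_mem (σ := σ) q (starRingEnd ℂ (1 / v)) (-(-(w / v).re))
  simp only [lineFun_conj] at this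
  refine (congrArg (· ∈ polyFunctions σ) (funext fun z => ?_)).mp this
  have : ((z : ℂ) - w) / v = 1 / v * z - w / v := by field_simp
  rw [this, Complex.sub_re]
  rfl

theorem polynomial_complex_mem (q : Polynomial ℂ) :
    (fun z : σ => q.eval (z : ℂ)) ∈ polyFunctions σ := by
  have hl : (fun z : σ => (z : ℂ)) ∈ polyFunctions σ := by
    refine ⟨MvPolynomial.X 0 + MvPolynomial.C Complex.I * MvPolynomial.X 1, ?_⟩
    funext z
    simp [mul_comm Complex.I]
  have : (fun z : σ => q.eval (z : ℂ)) = Polynomial.aeval (fun z : σ => (z : ℂ)) q := by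
    funext z
    induction q using Polynomial.induction_on' with
    | add p q hp hq => simp_all
    | monomial n a => simp [Polynomial.aeval_monomial]
  rw [this]
  exact Algebra.adjoin_le (singleton_subset_iff.mpr hl)
    (Polynomial.aeval_mem_adjoin_singleton _ _)

theorem IsCellDecomp.exists_cell (h : IsCellDecomp σ a b) (z : σ) :
    ∃ i, ∃ t ∈ Icc (0 : ℝ) 1, (z : ℂ) = AffineMap.lineMap (a i) (b i) t := by
  obtain ⟨i, hi⟩ := mem_iUnion.mp (h.cover.subset z.2)
  exact ⟨i, mem_segment_iff_lineMap.mp hi⟩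

/-- The map `z ↦ (z - p) / (q - p)` carries the segment from `p` to `q` onto the unit interval and
segments to segments, so the normalised case applies. -/
theorem exists_thin_rhombus_of_disjoint {p q c d : ℂ} (hpq : p ≠ q)
    (h : Disjoint (openSegment ℝ p q) (segment ℝ c d)) :
    ∃ ε : ℝ, 0 < ε ∧ ∀ z ∈ segment ℝ c d, ε * ((z - p) / (q - p)).re ≤ |((z - p) / (q - p)).im| ∨
      ε * (1 - ((z - p) / (q - p)).re) ≤ |((z - p) / (q - p)).im| := by
  have hv : q - p ≠ 0 := sub_ne_zero.mpr hpq.symm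
  have e : ∀ t : ℝ, (AffineMap.lineMap ((c - p) / (q - p)) ((d - p) / (q - p)) t : ℂ) =
      (AffineMap.lineMap c d t - p) / (q - p) := fun t => by
    rw [lineMap_eq_add, lineMap_eq_add]
    field_simp
    ring
  obtain ⟨ε, hε, H⟩ := exists_thin_rhombus (C := (c - p) / (q - p)) (D := (d - p) / (q - p))
    fun w hw him => by
      obtain ⟨t, ht, rfl⟩ := mem_segment_iff_lineMap.mp hw
      rw [e] at him ⊢
      by_contra! hre
      refine disjoint_left.mp h ?_ (mem_segment_iff_lineMap.mpr ⟨t, ht, rfl⟩)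
      refine mem_openSegment_iff_lineMap.mpr ⟨_, hre, ?_⟩
      have : ((AffineMap.lineMap c d t - p) / (q - p) : ℂ) =
          (((AffineMap.lineMap c d t - p) / (q - p) : ℂ).re : ℂ) :=
        Complex.ext (by simp) (by simp [him])
      rw [lineMap_eq_add p q, ← this]
      field_simp
      ring
  refine ⟨ε, hε, fun z hz => ?_⟩
  obtain ⟨t, ht, rfl⟩ := mem_segment_iff_lineMap.mp hz
  rw [← e]
  exact H _ (mem_segment_iff_lineMap.mpr ⟨t, ht, rfl⟩)

theorem sqrt_mul_sqrt_eq_zero {ε s t : ℝ} (h : ε * s ≤ |t|) : √(ε * s - t) * √(ε * s + t) = 0 := by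
  rcases le_abs.mp h with h | h
  · rw [Real.sqrt_eq_zero_of_nonpos (by linarith), zero_mul]
  · rw [Real.sqrt_eq_zero_of_nonpos (x := ε * s + t) (by linarith), mul_zero]

/-- A function in `AC(σ)` concentrated on a single cell. -/
theorem IsCellDecomp.exists_bump [Finite κ] (hσ : Bornology.IsBounded σ)
    (h : IsCellDecomp σ a b) {i : κ} (hi : a i ≠ b i) :
    ∃ P ∈ acFun σ, (∀ z : σ, (z : ℂ) ∉ openSegment ℝ (a i) (b i) → P z = 0) ∧
      ∀ (z : σ), ∀ t ∈ Icc (0 : ℝ) 1, (z : ℂ) = AffineMap.lineMap (a i) (b i) t →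
        P z = t * (1 - t) := by
  have hv : b i - a i ≠ 0 := sub_ne_zero.mpr hi.symm
  choose! E hE0 hE using fun j (hj : i ≠ j) => exists_thin_rhombus_of_disjoint hi (h.disj i j hj hi)
  obtain ⟨ε, hε, hεE⟩ : ∃ ε : ℝ, 0 < ε ∧ ∀ j, i ≠ j → ε ≤ E j := by
    -- Inserting 1 makes the minimum exist when there is no other cell.
    have hfin := Set.toFinite (insert 1 (E '' {j | i ≠ j}))
    have hm := hfin.toFinset.min'_mem ⟨1, by simp⟩
    refine ⟨hfin.toFinset.min' ⟨1, by simp⟩, ?_, fun j hj =>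
      Finset.min'_le _ _ (hfin.mem_toFinset.mpr (Or.inr ⟨j, hj, rfl⟩))⟩
    rcases hfin.mem_toFinset.mp hm with h1 | ⟨j, hj, h1⟩
    · rw [h1]; exact one_pos
    · rw [← h1]; exact hE0 j hj
  let s : ℂ → ℝ := fun z => ((z - a i) / (b i - a i)).re
  let t : ℂ → ℝ := fun z => ((z - a i) / (b i - a i)).im
  -- In the coordinates where the cell is `[0, 1]`, `Q` vanishes outside the rhombus `|t| < ε * min
  -- s (1 - s)`, hence on all other cells. On the axis the roots coincide in pairs and leave `ε ^ 2
  -- * s * (1 - s)`.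
  let Q : ℂ → ℝ := fun z => (√(ε * s z - t z) * √(ε * s z + t z)) *
    (√(ε * (1 - s z) - t z) * √(ε * (1 - s z) + t z))
  have hQ1 : ∀ z : σ, ∀ r ∈ Icc (0 : ℝ) 1, (z : ℂ) = AffineMap.lineMap (a i) (b i) r →
      Q z = ε ^ 2 * (r * (1 - r)) := by
    intro z r hr hz
    have e1 : s z = r := by simp only [s, hz, lineMap_sub_div hi, Complex.ofReal_re]
    have e2 : t z = 0 := by simp only [t, hz, lineMap_sub_div hi, Complex.ofReal_im]
    simp only [Q, e1, e2, sub_zero, add_zero]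
    rw [Real.mul_self_sqrt (mul_nonneg hε.le hr.1),
      Real.mul_self_sqrt (mul_nonneg hε.le (sub_nonneg.mpr hr.2))]
    ring
  have hne : ∀ x y : ℝ, y ≠ 0 → (⟨x, y⟩ : ℂ) ≠ 0 := fun x y hy h0 => hy (congrArg Complex.im h0)
  refine ⟨fun z => ((ε ^ 2 : ℝ) : ℂ)⁻¹ * Q z, ?_, fun z hz => ?_, fun z r hr hz => ?_⟩
  · have m1 := sqrt_re_mem_acFun hσ (hne ε 1 one_ne_zero) hv (a i) 0
    have m2 := sqrt_re_mem_acFun hσ (hne ε (-1) (by norm_num)) hv (a i) 0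
    have m3 := sqrt_re_mem_acFun hσ (hne (-ε) 1 one_ne_zero) hv (a i) ε
    have m4 := sqrt_re_mem_acFun hσ (hne (-ε) (-1) (by norm_num)) hv (a i) ε
    have key : ∀ (x y q : ℝ) (z : ℂ), ((⟨x, y⟩ : ℂ) * ((z - a i) / (b i - a i))).re + q =
        x * s z - y * t z + q := fun x y q z => by rw [Complex.mul_re]
    simp only [key] at m1 m2 m3 m4
    have := Subalgebra.smul_mem _ (mul_mem (mul_mem m1 m2) (mul_mem m3 m4)) ((ε ^ 2 : ℝ) : ℂ)⁻¹
    refine (congrArg (· ∈ acFun σ) (funext fun z => ?_)).mp this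
    simp only [Pi.smul_apply, Pi.mul_apply, smul_eq_mul, Q, Complex.ofReal_mul]
    rw [show ε * s z - t z = ε * s z - 1 * t z + 0 by ring,
      show ε * s z + t z = ε * s z - -1 * t z + 0 by ring,
      show ε * (1 - s z) - t z = -ε * s z - 1 * t z + ε by ring,
      show ε * (1 - s z) + t z = -ε * s z - -1 * t z + ε by ring]
  · have hQ0 : Q z = 0 := by
      obtain ⟨j, r, hr, hz'⟩ := h.exists_cell z
      by_cases hij : i = j
      · subst hij
        rw [hQ1 z r hr hz']
        have : r = 0 ∨ r = 1 := by
          by_contra! hcon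
          exact hz (mem_openSegment_iff_lineMap.mpr
            ⟨r, ⟨lt_of_le_of_ne hr.1 hcon.1.symm, lt_of_le_of_ne hr.2 hcon.2⟩, hz'⟩)
        rcases this with rfl | rfl <;> simp
      · have hlt : ∀ x y : ℝ, 0 ≤ y → E j * x ≤ y → ε * x ≤ y := fun x y hy hx => by
          rcases le_total 0 x with h0 | h0
          · exact (mul_le_mul_of_nonneg_right (hεE j hij) h0).trans hx
          · exact (mul_nonpos_of_nonneg_of_nonpos hε.le h0).trans hy
        rcases hE j hij z (mem_segment_iff_lineMap.mpr ⟨r, hr, hz'⟩) with h1 | h1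
        · simp only [Q]
          rw [sqrt_mul_sqrt_eq_zero (hlt _ _ (abs_nonneg _) h1), zero_mul]
        · simp only [Q]
          rw [sqrt_mul_sqrt_eq_zero (hlt _ _ (abs_nonneg _) h1), mul_zero]
    simp [hQ0]
  · simp only [hQ1 z r hr hz]
    have : (ε : ℂ) ≠ 0 := by exact_mod_cast hε.ne'
    push_cast
    field_simp

theorem exists_factor {Q : Polynomial ℂ} (h0 : Q.eval 0 = 0) (h1 : Q.eval 1 = 0) :
    ∃ R : Polynomial ℂ, ∀ t, Q.eval t = t * (1 - t) * R.eval t := by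
  obtain ⟨S, rfl⟩ := Polynomial.dvd_iff_isRoot.mpr h0
  have hS : S.IsRoot 1 := by simpa using h1
  obtain ⟨R, rfl⟩ := Polynomial.dvd_iff_isRoot.mpr hS
  refine ⟨-R, fun t => ?_⟩
  simp
  ring

/-- A function that is polynomial on every cell belongs to `AC(σ)`. -/
theorem IsCellDecomp.mem_acFun [Finite κ] (hσ : Bornology.IsBounded σ) (h : IsCellDecomp σ a b)
    {f : σ → ℂ} (hf : ∀ i, ∃ q : Polynomial ℂ, ∀ z : σ, ∀ t ∈ Icc (0 : ℝ) 1,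
      (z : ℂ) = AffineMap.lineMap (a i) (b i) t → f z = q.eval (t : ℂ)) : f ∈ acFun σ := by
  classical
  have := Fintype.ofFinite κ
  let V : Finset ℂ := Finset.univ.image a ∪ Finset.univ.image b
  let f₀ : ℂ → ℂ := fun z => if hz : z ∈ σ then f ⟨z, hz⟩ else 0
  -- A polynomial in the complex variable that agrees with `f` at all end points, including the
  -- one-point cells. The difference `f - p` can then be treated cell by cell.
  let p : Polynomial ℂ := Lagrange.interpolate V id f₀
  have hp : ∀ z : σ, (z : ℂ) ∈ V → p.eval (z : ℂ) = f z := fun z hz => by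
    have := Lagrange.eval_interpolate_at_node f₀ (s := V) (v := id) (injOn_id _) hz
    simp only [id] at this
    rw [this]
    simp [f₀]
  have haV : ∀ i, a i ∈ V := fun i => Finset.mem_union_left _ (Finset.mem_image_of_mem _ (by simp))
  have hbV : ∀ i, b i ∈ V := fun i => Finset.mem_union_right _ (Finset.mem_image_of_mem _ (by simp))
  have haσ : ∀ i, a i ∈ σ := fun i => by
    rw [h.cover]; exact mem_iUnion.mpr ⟨i, left_mem_segment _ _ _⟩
  have hbσ : ∀ i, b i ∈ σ := fun i => by
    rw [h.cover]; exact mem_iUnion.mpr ⟨i, right_mem_segment _ _ _⟩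
  have hVopen : ∀ z ∈ V, ∀ i, a i ≠ b i → z ∉ openSegment ℝ (a i) (b i) := by
    intro z hz i hi hzi
    have key : ∀ j, z = a j ∨ z = b j → False := fun j hj => by
      by_cases hij : i = j
      · subst hij
        rcases hj with rfl | rfl
        · exact left_notMem_openSegment hi hzi
        · exact right_notMem_openSegment hi hzi
      · refine disjoint_left.mp (h.disj i j hij hi) hzi ?_
        rcases hj with rfl | rfl
        · exact left_mem_segment _ _ _
        · exact right_mem_segment _ _ _
    rcases Finset.mem_union.mp hz with hz | hz
    · obtain ⟨j, -, rfl⟩ := Finset.mem_image.mp hz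
      exact key j (Or.inl rfl)
    · obtain ⟨j, -, rfl⟩ := Finset.mem_image.mp hz
      exact key j (Or.inr rfl)
  have hcell : ∀ i, ∃ g ∈ acFun σ, (∀ z : σ, (a i = b i ∨ (z : ℂ) ∉ openSegment ℝ (a i) (b i)) →
      g z = 0) ∧ (∀ z : σ, a i ≠ b i → (z : ℂ) ∈ openSegment ℝ (a i) (b i) →
        f z = p.eval (z : ℂ) + g z) := by
    intro i
    by_cases hi : a i = b i
    · exact ⟨0, zero_mem _, fun _ _ => rfl, fun _ hi' => absurd hi hi'⟩
    obtain ⟨P, hP, hP0, hP1⟩ := h.exists_bump hσ hi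
    obtain ⟨q, hq⟩ := hf i
    let Q := q - p.comp (Polynomial.C (a i) + Polynomial.X * Polynomial.C (b i - a i))
    have hQ : ∀ z : σ, ∀ t ∈ Icc (0 : ℝ) 1, (z : ℂ) = AffineMap.lineMap (a i) (b i) t →
        Q.eval (t : ℂ) = f z - p.eval (z : ℂ) := fun z t ht hz => by
      rw [hq z t ht hz, hz, lineMap_eq_add]
      simp [Q]
    -- On the cell, `f - p` is a polynomial in the parameter vanishing at both ends, so it is the
    -- bump `t * (1 - t)` times `R`.
    obtain ⟨R, hR⟩ := exists_factor (Q := Q)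
      (by simpa [hp ⟨a i, haσ i⟩ (haV i)] using hQ ⟨a i, haσ i⟩ 0 (by simp) (by simp))
      (by simpa [hp ⟨b i, hbσ i⟩ (hbV i)] using hQ ⟨b i, hbσ i⟩ 1 (by simp) (by simp))
    refine ⟨_, mul_mem hP (polyFunctions_le_acFun hσ (polynomial_re_mem R (b i - a i) (a i))),
      fun z hz => ?_, fun z _ hz => ?_⟩
    · rw [Pi.mul_apply, hP0 z (hz.resolve_left hi), zero_mul]
    · obtain ⟨t, ht, hz⟩ := mem_openSegment_iff_lineMap.mp hz
      have ht' := Ioo_subset_Icc_self ht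
      have := hQ z t ht' hz
      rw [hR] at this
      rw [Pi.mul_apply, hP1 z t ht' hz, hz, lineMap_sub_div hi, Complex.ofReal_re, this, hz]
      ring
  choose g hg hg0 hg1 using hcell
  have : f = (fun z : σ => p.eval (z : ℂ)) + ∑ i, g i := by
    funext z
    rw [Pi.add_apply, Finset.sum_apply]
    obtain ⟨i, t, ht, hz⟩ := h.exists_cell z
    rcases mem_openSegment_or_eq (mem_segment_iff_lineMap.mpr ⟨t, ht, hz⟩) with h1 | h1
    · have hzV : (z : ℂ) ∈ V := h1 ▸ haV i
      rw [Finset.sum_eq_zero fun j _ => hg0 j z (or_iff_not_imp_left.mpr (hVopen z hzV j)),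
        hp z hzV, add_zero]
    rcases h1 with h1 | h1
    · have hzV : (z : ℂ) ∈ V := h1 ▸ hbV i
      rw [Finset.sum_eq_zero fun j _ => hg0 j z (or_iff_not_imp_left.mpr (hVopen z hzV j)),
        hp z hzV, add_zero]
    · by_cases hi : a i = b i
      · rw [← hi, openSegment_same, mem_singleton_iff] at h1
        have hzV : (z : ℂ) ∈ V := h1 ▸ haV i
        rw [Finset.sum_eq_zero fun j _ => hg0 j z (or_iff_not_imp_left.mpr (hVopen z hzV j)),
          hp z hzV, add_zero]
      rw [Finset.sum_eq_single i, hg1 i z hi h1]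
      · intro j _ hji
        refine hg0 j z (or_iff_not_imp_left.mpr fun hj hzj => ?_)
        exact disjoint_left.mp (h.disj j i hji hj) hzj (openSegment_subset_segment _ _ _ h1)
      · simp
  rw [this]
  exact add_mem (polyFunctions_le_acFun hσ (polynomial_complex_mem p))
    (sum_mem fun i _ => hg i)

end Cells

/-! ### Separating lines and boundedness of composition in the variation norm. -/

section Norm

variable {κ : Type*} {σ τ : Set ℂ} {a b a' b' : κ → ℂ}

theorem exists_lineFun_separating_of_disjoint {p q r s : ℂ}
    (h : Disjoint (segment ℝ p q) (segment ℝ r s)) :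
    ∃ (u : ℂ) (c : ℝ), u ≠ 0 ∧ ∀ x ∈ segment ℝ p q, ∀ y ∈ segment ℝ r s,
      lineFun u c x * lineFun u c y < 0 := by
  have hcpt : ∀ p q : ℂ, IsCompact (segment ℝ p q) := fun p q => by
    rw [segment_eq_image_lineMap]
    exact isCompact_Icc.image AffineMap.lineMap_continuous
  obtain ⟨f, m, m', h1, hm, h2⟩ := geometric_hahn_banach_compact_closed (convex_segment p q)
    (hcpt p q) (convex_segment r s) (hcpt r s).isClosed h
  have hf : ∀ c z, lineFun ⟨f 1, f Complex.I⟩ c z = f z - c := fun c z => by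
    have : z = z.re • (1 : ℂ) + z.im • Complex.I := by
      simp [Complex.re_add_im]
    conv_rhs => rw [this, map_add, map_smul, map_smul]
    simp only [lineFun, smul_eq_mul]
    ring
  refine ⟨⟨f 1, f Complex.I⟩, m, fun h0 => ?_, fun x hx y hy => ?_⟩
  · have e : ∀ z, f z = 0 := fun z => by
      have := hf 0 z
      rw [h0] at this
      simpa [lineFun] using this.symm
    have := h1 p (left_mem_segment _ _ _)
    have := h2 r (left_mem_segment _ _ _)
    rw [e] at *
    linarith
  · rw [hf, hf]
    exact mul_neg_of_neg_of_pos (by linarith [h1 x hx]) (by linarith [h2 y hy])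

theorem exists_eq_add_mul_unit {v p : ℂ} (hp : v ≠ p) :
    ∃ (β : ℝ) (P : ℂ), 0 < β ∧ P.re ^ 2 + P.im ^ 2 = 1 ∧ p = v + β * P := by
  have h0 : ‖p - v‖ ≠ 0 := norm_ne_zero_iff.mpr (sub_ne_zero.mpr hp.symm)
  refine ⟨‖p - v‖, (p - v) / ‖p - v‖, by positivity, ?_, ?_⟩
  · have : ‖(p - v) / (‖p - v‖ : ℂ)‖ = 1 := by simp [h0]
    have h1 := Complex.sq_norm ((p - v) / (‖p - v‖ : ℂ))
    rw [this, Complex.normSq_apply] at h1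
    linarith
  · have : (‖p - v‖ : ℂ) ≠ 0 := by exact_mod_cast h0
    field_simp
    ring

/-- The line passes through `v` with normal `P - Q`, where `P` and `Q` are the unit directions of
the two segments: the inner products of `P - Q` with `P` and `Q` are `1 - ⟨P, Q⟩` and its negative.
Disjointness enters only through `P ≠ Q`. -/
theorem exists_lineFun_separating_of_common_left {v p q : ℂ} (hp : v ≠ p) (hq : v ≠ q)
    (h : Disjoint (openSegment ℝ v p) (openSegment ℝ v q)) :
    ∃ (u : ℂ) (c : ℝ), u ≠ 0 ∧ ∀ x ∈ segment ℝ v p, x ≠ v → ∀ y ∈ segment ℝ v q, y ≠ v →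
      lineFun u c x * lineFun u c y < 0 := by
  obtain ⟨β, P, hβ, hP, rfl⟩ := exists_eq_add_mul_unit hp
  obtain ⟨δ, Q, hδ, hQ, rfl⟩ := exists_eq_add_mul_unit hq
  have hPQ : P ≠ Q := by
    rintro rfl
    have hm : ∀ x : ℝ, 0 < x → min β δ ≤ x → v + ((min β δ / 2 : ℝ) : ℂ) * P ∈
        openSegment ℝ v (v + x * P) := fun x hx hle => by
      have hmin : 0 < min β δ := lt_min hβ hδ
      refine mem_openSegment_iff_lineMap.mpr ⟨min β δ / 2 / x,
        ⟨by positivity, (div_lt_one hx).mpr (by linarith)⟩, ?_⟩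
      have : (x : ℂ) ≠ 0 := by exact_mod_cast hx.ne'
      rw [lineMap_eq_add]
      push_cast
      field_simp
      ring
    exact disjoint_left.mp h (hm β hβ (min_le_left _ _)) (hm δ hδ (min_le_right _ _))
  have hpos : 0 < 1 - (P.re * Q.re + P.im * Q.im) := by
    have : 0 < (P.re - Q.re) ^ 2 + (P.im - Q.im) ^ 2 := by
      by_contra! hle
      have h1 : P.re - Q.re = 0 := by nlinarith [sq_nonneg (P.re - Q.re), sq_nonneg (P.im - Q.im)]
      have h2 : P.im - Q.im = 0 := by nlinarith [sq_nonneg (P.re - Q.re), sq_nonneg (P.im - Q.im)]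
      exact hPQ (Complex.ext (by linarith) (by linarith))
    nlinarith
  have key : ∀ z R : ℂ, ∀ r : ℝ, 0 < r → z ∈ segment ℝ v (v + r * R) → z ≠ v →
      ∃ t : ℝ, 0 < t ∧ z = v + t * R := by
    intro z R r hr hz hzv
    obtain ⟨t, ht, rfl⟩ := mem_segment_iff_lineMap.mp hz
    refine ⟨t * r, mul_pos (lt_of_le_of_ne ht.1 fun h0 => hzv ?_) hr, ?_⟩
    · rw [← h0]; simp
    · rw [lineMap_eq_add]; push_cast; ring
  refine ⟨P - Q, (P.re - Q.re) * v.re + (P.im - Q.im) * v.im, sub_ne_zero.mpr hPQ,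
    fun x hx hxv y hy hyv => ?_⟩
  obtain ⟨t, ht, rfl⟩ := key x P β hβ hx hxv
  obtain ⟨t', ht', rfl⟩ := key y Q δ hδ hy hyv
  have e : ∀ (t : ℝ) (R : ℂ), lineFun (P - Q) ((P.re - Q.re) * v.re + (P.im - Q.im) * v.im)
      (v + t * R) = t * ((P.re - Q.re) * R.re + (P.im - Q.im) * R.im) := fun t R => by
    simp [lineFun]
    ring
  rw [e, e]
  refine mul_neg_of_pos_of_neg (mul_pos ht ?_) (mul_neg_of_pos_of_neg ht' ?_)
  · nlinarith
  · nlinarith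

/-- Points of two cells outside the common part are strictly separated by a line that depends
only on the cells. -/
theorem IsCellDecomp.exists_separating (h : IsCellDecomp σ a b) (i j : κ) :
    ∃ (u : ℂ) (c : ℝ), u ≠ 0 ∧ ∀ x ∈ segment ℝ (a i) (b i), x ∉ segment ℝ (a j) (b j) →
      ∀ y ∈ segment ℝ (a j) (b j), y ∉ segment ℝ (a i) (b i) →
        lineFun u c x * lineFun u c y < 0 := by
  by_cases hd : Disjoint (segment ℝ (a i) (b i)) (segment ℝ (a j) (b j))
  · obtain ⟨u, c, hu, H⟩ := exists_lineFun_separating_of_disjoint hd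
    exact ⟨u, c, hu, fun x hx _ y hy _ => H x hx y hy⟩
  obtain ⟨v, hvi, hvj⟩ := not_disjoint_iff.mp hd
  -- If the cells have equal index, or if they meet and one is a single point, one is contained in
  -- the other. There is nothing to separate and any line serves.
  by_cases hij : i = j
  · subst hij
    exact ⟨1, 0, one_ne_zero, fun x hx hx' => absurd hx hx'⟩
  by_cases hi : a i = b i
  · refine ⟨1, 0, one_ne_zero, fun x hx hx' => absurd hvj ?_⟩
    rw [← hi, segment_same, mem_singleton_iff] at hx hvi
    rwa [hvi, ← hx]
  by_cases hj : a j = b j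
  · refine ⟨1, 0, one_ne_zero, fun x hx hx' y hy hy' => absurd hvi ?_⟩
    rw [← hj, segment_same, mem_singleton_iff] at hy hvj
    rwa [hvj, ← hy]
  have corner : ∀ p q : ℂ, segment ℝ v p = segment ℝ (a i) (b i) →
      segment ℝ v q = segment ℝ (a j) (b j) → openSegment ℝ v p = openSegment ℝ (a i) (b i) →
      openSegment ℝ v q = openSegment ℝ (a j) (b j) → v ≠ p → v ≠ q →
      ∃ (u : ℂ) (c : ℝ), u ≠ 0 ∧ ∀ x ∈ segment ℝ (a i) (b i), x ∉ segment ℝ (a j) (b j) →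
      ∀ y ∈ segment ℝ (a j) (b j), y ∉ segment ℝ (a i) (b i) →
        lineFun u c x * lineFun u c y < 0 := by
    intro p q h1 h2 h3 h4 hp hq
    have hdis : Disjoint (openSegment ℝ v p) (openSegment ℝ v q) := by
      rw [h3, h4]
      exact (h.disj i j hij hi).mono_right (openSegment_subset_segment _ _ _)
    obtain ⟨u, c, hu, H⟩ := exists_lineFun_separating_of_common_left hp hq hdis
    refine ⟨u, c, hu, fun x hx hx' y hy hy' => H x (h1 ▸ hx) ?_ y (h2 ▸ hy) ?_⟩
    · rintro rfl; exact hx' hvj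
    · rintro rfl; exact hy' hvi
  -- The interior of either cell misses the other, so the common point is an end point of both.
  have hv1 : v = a i ∨ v = b i := by
    rcases mem_openSegment_or_eq hvi with h1 | h1 | h1
    · exact Or.inl h1
    · exact Or.inr h1
    · exact absurd hvj (disjoint_left.mp (h.disj i j hij hi) h1)
  have hv2 : v = a j ∨ v = b j := by
    rcases mem_openSegment_or_eq hvj with h1 | h1 | h1
    · exact Or.inl h1
    · exact Or.inr h1
    · exact absurd hvi (disjoint_left.mp (h.disj j i (Ne.symm hij) hj) h1)
  rcases hv1 with rfl | rfl <;> rcases hv2 with e | e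
  · exact corner (b i) (b j) rfl (by rw [e]) rfl (by rw [e]) hi (e ▸ hj)
  · exact corner (b i) (a j) rfl (by rw [e, segment_symm]) rfl (by rw [e, openSegment_symm]) hi
      (e ▸ Ne.symm hj)
  · exact corner (a i) (b j) (segment_symm _ _ _) (by rw [e]) (openSegment_symm _ _ _) (by rw [e])
      (Ne.symm hi) (e ▸ hj)
  · exact corner (a i) (a j) (segment_symm _ _ _) (by rw [e, segment_symm])
      (openSegment_symm _ _ _) (by rw [e, openSegment_symm]) (Ne.symm hi) (e ▸ Ne.symm hj)

/-- For increasing values `y`, a crossing at `i` means `y i = 0` or `y (i + 1) > 0`, whereas a later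
crossing at `j` needs `y j < 0`, or `y j = 0` with `y (j - 1) < 0`. The decreasing case is
symmetric. -/
theorem not_isCrossing_of_lt_of_monotone {u : ℂ} {c : ℝ} {x : ℕ → ℂ}
    (hx : Monotone (fun i => lineFun u c (x i)) ∨ Antitone (fun i => lineFun u c (x i)))
    {i j : ℕ} (hij : i < j) (hi : IsCrossing u c x i) (hj : IsCrossing u c x j) : False := by
  unfold IsCrossing at hi hj
  generalize hy : (fun i => lineFun u c (x i)) = y at hx
  have e : ∀ i, lineFun u c (x i) = y i := fun i => congrFun hy i
  simp only [e] at hi hj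
  rcases hx with hx | hx
  · have h1 : y i ≤ y (i + 1) := hx (by omega)
    have h2 : y (i + 1) ≤ y j := hx (by omega)
    have h3 : y j ≤ y (j + 1) := hx (by omega)
    have h4 : y i ≤ y (j - 1) := hx (by omega)
    have h5 : y (j - 1) ≤ y j := hx (by omega)
    rcases hj with hj | ⟨hj, -⟩ | ⟨-, hj, hj'⟩
    · have : y j < 0 := by by_contra! h0; nlinarith
      rcases hi with hi | ⟨-, hi⟩ | ⟨-, hi, -⟩ <;> nlinarith
    · omega
    · have : y (j - 1) < 0 := lt_of_le_of_ne (hj ▸ h5) hj'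
      rcases hi with hi | ⟨-, hi⟩ | ⟨-, hi, -⟩ <;> nlinarith
  · have h1 : y (i + 1) ≤ y i := hx (by omega)
    have h2 : y j ≤ y (i + 1) := hx (by omega)
    have h3 : y (j + 1) ≤ y j := hx (by omega)
    have h4 : y (j - 1) ≤ y i := hx (by omega)
    have h5 : y j ≤ y (j - 1) := hx (by omega)
    rcases hj with hj | ⟨hj, -⟩ | ⟨-, hj, hj'⟩
    · have : 0 < y j := by by_contra! h0; nlinarith
      rcases hi with hi | ⟨-, hi⟩ | ⟨-, hi, -⟩ <;> nlinarith
    · omega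
    · have : 0 < y (j - 1) := lt_of_le_of_ne (hj ▸ h5) (Ne.symm hj')
      rcases hi with hi | ⟨-, hi⟩ | ⟨-, hi, -⟩ <;> nlinarith

/-- A list of points in monotone order on a segment has variation factor at most one. -/
theorem vf_lineMap_le_one (p q : ℂ) {t : ℕ → ℝ} (ht : Monotone t) (n : ℕ) :
    vf (fun i => AffineMap.lineMap p q (t i)) n ≤ 1 := by
  classical
  by_cases hn : n = 0
  · simp [vf, hn]
  obtain ⟨u, c, -, h⟩ := exists_crossings_eq_vf (fun i => AffineMap.lineMap p q (t i)) hn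
  rw [h]
  have e : ∀ i, lineFun u c (AffineMap.lineMap p q (t i)) = lineFun u c p +
      t i * (u.re * (q.re - p.re) + u.im * (q.im - p.im)) := fun i => by
    rw [lineMap_eq_add]
    simp [lineFun]
    ring
  have hm : Monotone (fun i => lineFun u c (AffineMap.lineMap p q (t i))) ∨
      Antitone (fun i => lineFun u c (AffineMap.lineMap p q (t i))) := by
    simp only [e]
    rcases le_total 0 (u.re * (q.re - p.re) + u.im * (q.im - p.im)) with h0 | h0
    · left
      intro i j hij
      have := mul_le_mul_of_nonneg_right (ht hij) h0
      simpa using this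
    · right
      intro i j hij
      have := mul_le_mul_of_nonpos_right (ht hij) h0
      simpa using this
  refine Finset.card_le_one.mpr fun i hi j hj => ?_
  have hi := (Finset.mem_filter.mp hi).2
  have hj := (Finset.mem_filter.mp hj).2
  rcases lt_trichotomy i j with h1 | h1 | h1
  · exact (not_isCrossing_of_lt_of_monotone hm h1 hi hj).elim
  · exact h1
  · exact (not_isCrossing_of_lt_of_monotone hm h1 hj hi).elim

/-- Monotone lists along a segment have variation factor exactly 1, so their classical variation
sums are among the quotients defining `var`. -/
theorem eVariationOn_segment_le_var (f : τ → ℂ) {p q : ℂ} {γ : ℝ → τ}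
    (hγ : ∀ t ∈ Icc (0 : ℝ) 1, (γ t : ℂ) = AffineMap.lineMap p q t) :
    eVariationOn (fun t => f (γ t)) (Icc 0 1) ≤ var f := by
  refine iSup_le fun ⟨n, t, ht, htm⟩ => ?_
  refine le_trans ?_ (cvar_div_le_var f (fun i => γ (t i)) n)
  have e : (fun i => ((γ (t i) : τ) : ℂ)) = fun i => AffineMap.lineMap p q (t i) :=
    funext fun i => hγ _ (htm i)
  have h1 : vf (fun i => ((γ (t i) : τ) : ℂ)) n = 1 :=
    le_antisymm (e ▸ vf_lineMap_le_one p q ht n) (one_le_vf _ _)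
  rw [h1, Nat.cast_one, div_one]
  exact Finset.sum_le_sum fun i _ => (edist_eq_enorm_sub _ _).le

/-- The steps of a list inside one segment contribute at most the variation factor times the
variation along the segment. -/
theorem sum_enorm_sub_le_of_mem_segment {F : σ → ℂ} {g : ℝ → ℂ} {p q : ℂ}
    (hF : ∀ z : σ, ∀ t ∈ Icc (0 : ℝ) 1, (z : ℂ) = AffineMap.lineMap p q t → F z = g t)
    (x : ℕ → σ) (n : ℕ) {I : Finset ℕ} (hI : I ⊆ Finset.range n)
    (hx : ∀ j ∈ I, (x j : ℂ) ∈ segment ℝ p q ∧ (x (j + 1) : ℂ) ∈ segment ℝ p q) :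
    ∑ j ∈ I, ‖F (x (j + 1)) - F (x j)‖ₑ ≤
      vf (fun i => (x i : ℂ)) n * eVariationOn g (Icc 0 1) := by
  by_cases htop : eVariationOn g (Icc 0 1) = ∞
  · rw [htop, ENNReal.mul_top (by exact_mod_cast Nat.one_le_iff_ne_zero.mp (one_le_vf _ _))]
    exact le_top
  by_cases hpq : p = q
  · refine le_of_eq_of_le (Finset.sum_eq_zero fun j hj => ?_) zero_le
    obtain ⟨h1, h2⟩ := hx j hj
    rw [← hpq, segment_same, mem_singleton_iff] at h1 h2
    rw [Subtype.ext (h2.trans h1.symm), sub_self, enorm_zero]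
  -- The cumulative variation of `g` is bounded, monotone on the whole line, and dominates the
  -- increments of `g`. Composed with the coordinate `s` along the segment it is defined on the
  -- plane, so the sum may be enlarged to all steps of the list.
  let V : ℝ → ℝ := fun t => (eVariationOn g (Icc 0 1 ∩ Iic t)).toReal
  have hfin : ∀ t, eVariationOn g (Icc 0 1 ∩ Iic t) ≠ ∞ := fun t =>
    ne_top_of_le_ne_top htop (eVariationOn.mono g inter_subset_left)
  have hVm : Monotone V := fun s t hst => ENNReal.toReal_mono (hfin t)
    (eVariationOn.mono g (inter_subset_inter_right _ (Iic_subset_Iic.mpr hst)))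
  have hVg : ∀ s ∈ Icc (0 : ℝ) 1, ∀ t ∈ Icc (0 : ℝ) 1, s ≤ t → ‖g t - g s‖ₑ ≤
      ENNReal.ofReal (V t - V s) := by
    intro s hs t ht hst
    rw [ENNReal.ofReal_sub _ ENNReal.toReal_nonneg, ENNReal.ofReal_toReal (hfin t),
      ENNReal.ofReal_toReal (hfin s)]
    refine ENNReal.le_sub_of_add_le_left (hfin s) ?_
    have h1 := eVariationOn.add_le_union g (s := Icc 0 1 ∩ Iic s) (t := {s, t})
      fun y hy z hz => by
        rcases hz with rfl | rfl
        · exact hy.2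
        · exact le_trans hy.2 hst
    rw [eVariationOn.pair, edist_comm, edist_eq_enorm_sub] at h1
    refine h1.trans (eVariationOn.mono g ?_)
    rintro y (hy | rfl | rfl)
    · exact ⟨hy.1, le_trans hy.2 hst⟩
    · exact ⟨hs, hst⟩
    · exact ⟨ht, le_refl y⟩
  have hv : q - p ≠ 0 := sub_ne_zero.mpr (Ne.symm hpq)
  have hu : starRingEnd ℂ (1 / (q - p)) ≠ 0 :=
    (map_ne_zero _).mpr (one_div_ne_zero hv)
  let s : ℂ → ℝ := lineFun (starRingEnd ℂ (1 / (q - p))) (-(-(p / (q - p)).re))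
  have hs : ∀ t : ℝ, s (AffineMap.lineMap p q t) = t := fun t => by
    have e : 1 / (q - p) * (AffineMap.lineMap p q t : ℂ) - p / (q - p) =
        (AffineMap.lineMap p q t - p) / (q - p) := by field_simp
    simp only [s, lineFun_conj]
    rw [← sub_eq_add_neg, ← Complex.sub_re, e, lineMap_sub_div hpq, Complex.ofReal_re]
  calc ∑ j ∈ I, ‖F (x (j + 1)) - F (x j)‖ₑ
      ≤ ∑ j ∈ I, ‖V (s (x (j + 1))) - V (s (x j))‖ₑ := Finset.sum_le_sum fun j hj => by
        obtain ⟨h1, h2⟩ := hx j hj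
        obtain ⟨t₁, ht₁, e₁⟩ := mem_segment_iff_lineMap.mp h1
        obtain ⟨t₂, ht₂, e₂⟩ := mem_segment_iff_lineMap.mp h2
        rw [hF _ t₁ ht₁ e₁, hF _ t₂ ht₂ e₂, e₁, e₂, hs, hs, ← ofReal_norm (V t₂ - V t₁),
          Real.norm_eq_abs]
        rcases le_total t₁ t₂ with hle | hle
        · exact (hVg _ ht₁ _ ht₂ hle).trans (ENNReal.ofReal_le_ofReal (le_abs_self _))
        · rw [← enorm_neg, neg_sub, abs_sub_comm]
          exact (hVg _ ht₂ _ ht₁ hle).trans (ENNReal.ofReal_le_ofReal (le_abs_self _))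
    _ ≤ ∑ j ∈ Finset.range n, ‖V (s (x (j + 1))) - V (s (x j))‖ₑ :=
        Finset.sum_le_sum_of_subset hI
    _ ≤ vf (fun i => (x i : ℂ)) n * ENNReal.ofReal (eVariationOn g (Icc 0 1)).toReal :=
        sum_enorm_sub_le_vf hu _ (fun i => (x i : ℂ)) n hVm (fun _ => ENNReal.toReal_nonneg)
          fun t => ENNReal.toReal_mono htop (eVariationOn.mono g inter_subset_left)
    _ = _ := by rw [ENNReal.ofReal_toReal htop]

/-- `k` maps the segment `[a i, b i]` affinely onto `[a' i, b' i]`, for all `i`. -/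
def IsCellAffine (a b a' b' : κ → ℂ) (k : σ → τ) : Prop :=
  ∀ i, ∀ z : σ, ∀ t ∈ Icc (0 : ℝ) 1, (z : ℂ) = AffineMap.lineMap (a i) (b i) t →
    (k z : ℂ) = AffineMap.lineMap (a' i) (b' i) t

/-- Steps with both ends in one cell cost at most `vf * var f` per cell. Every other step, for some
ordered pair of cells, strictly crosses the line attached to that pair; there are at most `vf` of
these per pair, each costing at most `2 * supNorm f`. The image cells need not form a decomposition.
-/
theorem IsCellDecomp.var_comp_le [Fintype κ] (h : IsCellDecomp σ a b) {k : σ → τ}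
    (hk : IsCellAffine a b a' b' k) (f : τ → ℂ) :
    var (f ∘ k) ≤ Fintype.card κ * var f + Fintype.card κ ^ 2 * (2 * supNorm f) := by
  classical
  refine iSup₂_le fun x n => ENNReal.div_le_of_le_mul' ?_
  set m : ℝ≥0∞ := (vf (fun i => (x i : ℂ)) n : ℝ≥0∞) with hm
  let S : κ → Set ℂ := fun i => segment ℝ (a i) (b i)
  let I : κ → Finset ℕ := fun i =>
    (Finset.range n).filter fun j => (x j : ℂ) ∈ S i ∧ (x (j + 1) : ℂ) ∈ S i
  let J : κ × κ → Finset ℕ := fun p => (Finset.range n).filter fun j =>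
    ((x j : ℂ) ∈ S p.1 ∧ (x j : ℂ) ∉ S p.2) ∧ (x (j + 1) : ℂ) ∈ S p.2 ∧ (x (j + 1) : ℂ) ∉ S p.1
  let T : ℕ → ℝ≥0∞ := fun j => ‖(f ∘ k) (x (j + 1)) - (f ∘ k) (x j)‖ₑ
  have hIb : ∀ i, ∑ j ∈ I i, T j ≤ m * var f := by
    intro i
    have hmem : ∀ t ∈ Icc (0 : ℝ) 1, (AffineMap.lineMap (a i) (b i) t : ℂ) ∈ σ := fun t ht => by
      rw [h.cover]
      exact mem_iUnion.mpr ⟨i, mem_segment_iff_lineMap.mpr ⟨t, ht, rfl⟩⟩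
    let γ : ℝ → τ := fun t => k ⟨AffineMap.lineMap (a i) (b i) (projIcc (0 : ℝ) 1 zero_le_one t : ℝ),
      hmem _ (projIcc (0 : ℝ) 1 zero_le_one t).2⟩
    have hγ : ∀ t ∈ Icc (0 : ℝ) 1, (γ t : ℂ) = AffineMap.lineMap (a' i) (b' i) t := fun t ht => by
      refine hk i _ t ht ?_
      simp only [projIcc_of_mem zero_le_one ht]
    refine (sum_enorm_sub_le_of_mem_segment (g := fun t => f (γ t)) (p := a i) (q := b i)
      (fun z t ht hz => ?_) x n (Finset.filter_subset _ _)
      fun j hj => (Finset.mem_filter.mp hj).2).trans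
        (mul_le_mul_right (eVariationOn_segment_le_var f hγ) _)
    have : k z = γ t := Subtype.ext ((hk i z t ht hz).trans (hγ t ht).symm)
    simp [this]
  have hJb : ∀ p, ∑ j ∈ J p, T j ≤ m * (2 * supNorm f) := by
    intro p
    obtain ⟨u, c, hu, H⟩ := h.exists_separating p.1 p.2
    have hcard : ((J p).card : ℝ≥0∞) ≤ m := by
      refine Nat.cast_le.mpr (le_trans ?_ (crossings_le_vf hu c (fun i => (x i : ℂ)) n))
      unfold crossings
      refine Finset.card_le_card (Finset.monotone_filter_right _ fun j _ hj => Or.inl ?_)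
      exact H _ hj.1.1 hj.1.2 _ hj.2.1 hj.2.2
    calc ∑ j ∈ J p, T j ≤ ∑ j ∈ J p, 2 * supNorm f := Finset.sum_le_sum fun j _ => by
          refine enorm_sub_le.trans ?_
          rw [two_mul]
          exact add_le_add (enorm_le_supNorm f _) (enorm_le_supNorm f _)
      _ = (J p).card * (2 * supNorm f) := by rw [Finset.sum_const, nsmul_eq_mul]
      _ ≤ m * (2 * supNorm f) := mul_le_mul_left hcard _
  have hcov : cvar (f ∘ k) x n ≤ ∑ i, ∑ j ∈ I i, T j + ∑ p, ∑ j ∈ J p, T j := by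
    have e1 : ∀ i, ∑ j ∈ I i, T j = ∑ j ∈ Finset.range n, if j ∈ I i then T j else 0 := fun i => by
      rw [← Finset.sum_filter]
      refine Finset.sum_congr ?_ fun _ _ => rfl
      ext j; simp only [I, Finset.mem_filter]; tauto
    have e2 : ∀ i, ∑ j ∈ J i, T j = ∑ j ∈ Finset.range n, if j ∈ J i then T j else 0 := fun i => by
      rw [← Finset.sum_filter]
      refine Finset.sum_congr ?_ fun _ _ => rfl
      ext j; simp only [J, Finset.mem_filter]; tauto
    simp only [e1, e2]
    rw [Finset.sum_comm, Finset.sum_comm (s := (Finset.univ : Finset (κ × κ))),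
      ← Finset.sum_add_distrib]
    refine Finset.sum_le_sum fun j hj => ?_
    change T j ≤ _
    by_cases hsame : ∃ i, j ∈ I i
    · obtain ⟨i, hi⟩ := hsame
      refine le_trans ?_ le_self_add
      refine le_trans ?_ (Finset.single_le_sum (fun _ _ => zero_le) (Finset.mem_univ i))
      rw [if_pos hi]
    · obtain ⟨i₁, t₁, ht₁, e₁⟩ := h.exists_cell (x j)
      obtain ⟨i₂, t₂, ht₂, e₂⟩ := h.exists_cell (x (j + 1))
      have m1 : (x j : ℂ) ∈ S i₁ := mem_segment_iff_lineMap.mpr ⟨t₁, ht₁, e₁⟩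
      have m2 : (x (j + 1) : ℂ) ∈ S i₂ := mem_segment_iff_lineMap.mpr ⟨t₂, ht₂, e₂⟩
      have hJ : j ∈ J (i₁, i₂) := by
        refine Finset.mem_filter.mpr ⟨hj, ⟨m1, fun hc => hsame ⟨i₂, ?_⟩⟩, m2,
          fun hc => hsame ⟨i₁, ?_⟩⟩
        · exact Finset.mem_filter.mpr ⟨hj, hc, m2⟩
        · exact Finset.mem_filter.mpr ⟨hj, m1, hc⟩
      refine le_trans ?_ le_add_self
      refine le_trans ?_ (Finset.single_le_sum (fun _ _ => zero_le) (Finset.mem_univ (i₁, i₂)))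
      rw [if_pos hJ]
  refine hcov.trans ?_
  calc ∑ i, ∑ j ∈ I i, T j + ∑ p, ∑ j ∈ J p, T j
      ≤ ∑ _i : κ, m * var f + ∑ _p : κ × κ, m * (2 * supNorm f) :=
        add_le_add (Finset.sum_le_sum fun i _ => hIb i) (Finset.sum_le_sum fun p _ => hJb p)
    _ = m * (Fintype.card κ * var f + Fintype.card κ ^ 2 * (2 * supNorm f)) := by
        simp only [Finset.sum_const, Finset.card_univ, nsmul_eq_mul, Fintype.card_prod,
          Nat.cast_mul]
        ring

theorem IsCellDecomp.bvNorm_comp_le [Fintype κ] (h : IsCellDecomp σ a b) {k : σ → τ}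
    (hk : IsCellAffine a b a' b' k) (f : τ → ℂ) :
    bvNorm (f ∘ k) ≤ ((1 + Fintype.card κ + 2 * Fintype.card κ ^ 2 : ℕ) : ℝ≥0∞) * bvNorm f := by
  have h1 : supNorm (f ∘ k) ≤ supNorm f := iSup_le fun z => enorm_le_supNorm f (k z)
  refine (add_le_add h1 (h.var_comp_le hk f)).trans ?_
  have h2 : supNorm f ≤ bvNorm f := le_self_add
  have h3 : var f ≤ bvNorm f := le_add_self
  push_cast
  calc supNorm f + (Fintype.card κ * var f + Fintype.card κ ^ 2 * (2 * supNorm f))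
      ≤ bvNorm f + (Fintype.card κ * bvNorm f + Fintype.card κ ^ 2 * (2 * bvNorm f)) := by gcongr
    _ = _ := by ring

end Norm

/-! ### Cellwise affine bijections induce isomorphisms. -/

section Composition

variable {κ : Type*} {σ τ : Set ℂ} {a b a' b' : κ → ℂ}

/-- Composition with `k` as a homomorphism of function algebras. -/
def precomp (k : σ → τ) : (τ → ℂ) →ₐ[ℂ] (σ → ℂ) where
  toFun f := f ∘ k
  map_one' := rfl
  map_mul' _ _ := rfl
  map_zero' := rfl
  map_add' _ _ := rfl
  commutes' _ := rfl

/-- Since `acFun σ` is an algebra, only the two coordinates of `k` matter, and these are affine in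
the parameter of each cell. -/
theorem precomp_mem_acFun [Finite κ] (hσ : Bornology.IsBounded σ) (h : IsCellDecomp σ a b)
    {k : σ → τ} (hk : IsCellAffine a b a' b' k) {p : τ → ℂ} (hp : p ∈ polyFunctions τ) :
    p ∘ k ∈ acFun σ := by
  suffices polyFunctions τ ≤ (acFun σ).comap (precomp k) from this hp
  have key : ∀ π : ℂ → ℝ, (∀ (z w : ℂ) (t : ℝ),
      π (AffineMap.lineMap z w t) = π z + t * (π w - π z)) →
      (fun z : τ => ((π z : ℝ) : ℂ)) ∘ k ∈ acFun σ := by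
    intro π hπ
    refine h.mem_acFun hσ fun i => ⟨Polynomial.C (π (a' i) : ℂ) +
      Polynomial.X * Polynomial.C ((π (b' i) - π (a' i) : ℝ) : ℂ), fun z t ht hz => ?_⟩
    simp only [Function.comp_apply, hk i z t ht hz, hπ]
    simp
  rw [polyFunctions, ← Algebra.adjoin_range_eq_range_aeval, Algebra.adjoin_le_iff]
  rintro f ⟨i, rfl⟩
  fin_cases i
  · exact key Complex.re fun z w t => by rw [lineMap_eq_add]; simp
  · exact key Complex.im fun z w t => by rw [lineMap_eq_add]; simp

theorem exists_bv_precomp {k : σ → τ} {C : ℕ} (hC : ∀ f : τ → ℂ, bvNorm (f ∘ k) ≤ C * bvNorm f) :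
    ∃ Φ : BV τ →ₐ[ℂ] BV σ, Continuous Φ ∧ ∀ F, BV.val σ (Φ F) = BV.val τ F ∘ k := by
  let Φ : BV τ →ₐ[ℂ] BV σ := ((precomp k).comp (BV.val τ)).codRestrict (bvSubalgebra σ)
    fun F => (hC _).trans_lt (ENNReal.mul_lt_top (ENNReal.natCast_lt_top C) F.bvNorm_lt_top)
  have hΦ : ∀ F, BV.val σ (Φ F) = BV.val τ F ∘ k := fun F => rfl
  refine ⟨Φ, AddMonoidHomClass.continuous_of_bound Φ C fun F => ?_, hΦ⟩
  rw [BV.norm_def, BV.norm_def, hΦ, ← ENNReal.toReal_natCast, ← ENNReal.toReal_mul]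
  exact ENNReal.toReal_mono
    (ENNReal.mul_lt_top (ENNReal.natCast_lt_top C) F.bvNorm_lt_top).ne (hC _)

/-- Composition is continuous on `BV` and sends polynomial functions into the closed algebra `AC σ`,
hence also their closure. -/
theorem exists_ac_precomp [Finite κ] (hσ : Bornology.IsBounded σ) (h : IsCellDecomp σ a b)
    {k : σ → τ} (hk : IsCellAffine a b a' b' k) :
    ∃ Φ : AC τ →ₐ[ℂ] AC σ, Continuous Φ ∧
      ∀ F : AC τ, BV.val σ (Φ F : BV σ) = BV.val τ (F : BV τ) ∘ k := by
  have := Fintype.ofFinite κ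
  obtain ⟨Φ, hΦc, hΦ⟩ := exists_bv_precomp (h.bvNorm_comp_le hk)
  have hmem : ∀ F ∈ AC τ, Φ F ∈ AC σ := fun F hF => by
    have hcl : IsClosed (AC σ : Set (BV σ)) := Subalgebra.isClosed_topologicalClosure _
    have := map_mem_closure (s := (((polyFunctions τ).comap (BV.val τ) : Subalgebra ℂ (BV τ)) :
      Set (BV τ))) (t := (AC σ : Set (BV σ))) hΦc hF fun P hP => by
        obtain ⟨Q, hQ, hQP⟩ := precomp_mem_acFun hσ h hk hP
        have : Φ P = Q := BV.val_injective ((hΦ P).trans hQP.symm)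
        rw [this]
        exact hQ
    rwa [hcl.closure_eq] at this
  refine ⟨(Φ.comp (AC τ).val).codRestrict (AC σ) fun F => hmem F F.2, ?_, fun F => hΦ F⟩
  exact (hΦc.comp continuous_subtype_val).subtype_mk _

theorem IsCellAffine.symm (h : IsCellDecomp σ a b) {k : σ ≃ τ} (hk : IsCellAffine a b a' b' k) :
    IsCellAffine a' b' a b k.symm := by
  intro i z t ht hz
  have hw : (AffineMap.lineMap (a i) (b i) t : ℂ) ∈ σ := by
    rw [h.cover]
    exact mem_iUnion.mpr ⟨i, mem_segment_iff_lineMap.mpr ⟨t, ht, rfl⟩⟩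
  have : k ⟨_, hw⟩ = z := Subtype.ext ((hk i ⟨_, hw⟩ t ht rfl).trans hz.symm)
  rw [← this, Equiv.symm_apply_apply]

/-- A bijection that is affine on the cells of decompositions induces an isomorphism. -/
theorem nonempty_continuousAlgEquiv_of_isCellAffine [Finite κ] (hσ : Bornology.IsBounded σ)
    (hτ : Bornology.IsBounded τ) (h : IsCellDecomp σ a b) (h' : IsCellDecomp τ a' b') (k : σ ≃ τ)
    (hk : IsCellAffine a b a' b' k) : Nonempty (AC σ ≃A[ℂ] AC τ) := by
  obtain ⟨Φ, hΦc, hΦ⟩ := exists_ac_precomp hσ h hk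
  obtain ⟨Ψ, hΨc, hΨ⟩ := exists_ac_precomp hτ h' (hk.symm h)
  have e1 : Φ.comp Ψ = AlgHom.id ℂ (AC σ) := AlgHom.ext fun F =>
    Subtype.ext (BV.val_injective (by
      rw [AlgHom.comp_apply, hΦ, hΨ]
      funext z
      simp))
  have e2 : Ψ.comp Φ = AlgHom.id ℂ (AC τ) := AlgHom.ext fun F =>
    Subtype.ext (BV.val_injective (by
      rw [AlgHom.comp_apply, hΨ, hΦ]
      funext z
      simp))
  exact ⟨{ AlgEquiv.ofAlgHom Ψ Φ e2 e1 with
    continuous_toFun := hΨc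
    continuous_invFun := hΦc }⟩

end Composition

/-! ### Continuous characters are evaluations. -/

section Characters

variable {σ τ : Set ℂ}

theorem supNorm_pow_le (f : σ → ℂ) (n : ℕ) : supNorm (f ^ n) ≤ supNorm f ^ n :=
  iSup_le fun z => by
    rw [Pi.pow_apply, enorm_pow]
    exact pow_le_pow_left' (enorm_le_supNorm f z) n

theorem var_mul_le (f g : σ → ℂ) : var (f * g) ≤ supNorm f * var g + supNorm g * var f :=
  iSup₂_le fun x n => by
    have h : cvar (f * g) x n ≤ supNorm f * cvar g x n + supNorm g * cvar f x n := by
      unfold cvar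
      rw [Finset.mul_sum, Finset.mul_sum, ← Finset.sum_add_distrib]
      refine Finset.sum_le_sum fun i _ => ?_
      have e : (f * g) (x (i + 1)) - (f * g) (x i) =
          f (x (i + 1)) * (g (x (i + 1)) - g (x i)) + g (x i) * (f (x (i + 1)) - f (x i)) := by
        simp only [Pi.mul_apply]
        ring
      rw [e]
      refine (enorm_add_le _ _).trans ?_
      rw [enorm_mul, enorm_mul]
      exact add_le_add (mul_le_mul_left (enorm_le_supNorm f _) _)
        (mul_le_mul_left (enorm_le_supNorm g _) _)
    refine (ENNReal.div_le_div_right h _).trans ?_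
    rw [ENNReal.add_div, mul_div_assoc, mul_div_assoc]
    exact add_le_add (mul_le_mul_right (cvar_div_le_var g x n) _)
      (mul_le_mul_right (cvar_div_le_var f x n) _)

theorem var_pow_le (f : σ → ℂ) (n : ℕ) :
    var (f ^ (n + 1)) ≤ (n + 1) * supNorm f ^ n * var f := by
  induction n with
  | zero => simp
  | succ n ih =>
    rw [pow_succ]
    calc var (f ^ (n + 1) * f) ≤ supNorm (f ^ (n + 1)) * var f + supNorm f * var (f ^ (n + 1)) :=
          var_mul_le _ _
      _ ≤ supNorm f ^ (n + 1) * var f + supNorm f * ((n + 1) * supNorm f ^ n * var f) :=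
          add_le_add (mul_le_mul_left (supNorm_pow_le f _) _) (mul_le_mul_right ih _)
      _ = ((n + 1 : ℕ) + 1) * supNorm f ^ (n + 1) * var f := by push_cast; ring

theorem BV.supNorm_lt_top (F : BV σ) : supNorm (BV.val σ F) < ∞ :=
  lt_of_le_of_lt le_self_add F.bvNorm_lt_top

/-- By the Leibniz rule the variation of a power carries only a linear factor in the exponent; the
spectral radius is therefore at most the supremum norm. -/
theorem BV.norm_pow_succ_le (F : BV σ) (n : ℕ) :
    ‖F ^ (n + 1)‖ ≤ (supNorm (BV.val σ F)).toReal ^ n * ((n + 2) * ‖F‖) := by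
  have hv : var (BV.val σ F) ≤ bvNorm (BV.val σ F) := le_add_self
  have hs : supNorm (BV.val σ F) ≤ bvNorm (BV.val σ F) := le_self_add
  have h : bvNorm (BV.val σ F ^ (n + 1)) ≤
      supNorm (BV.val σ F) ^ n * ((n + 2 : ℕ) * bvNorm (BV.val σ F)) := by
    calc bvNorm (BV.val σ F ^ (n + 1))
        ≤ supNorm (BV.val σ F) ^ (n + 1) +
          (n + 1) * supNorm (BV.val σ F) ^ n * var (BV.val σ F) :=
          add_le_add (supNorm_pow_le _ _) (var_pow_le _ _)
      _ ≤ supNorm (BV.val σ F) ^ n * bvNorm (BV.val σ F) +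
          (n + 1) * supNorm (BV.val σ F) ^ n * bvNorm (BV.val σ F) := by
          rw [pow_succ]; gcongr
      _ = _ := by push_cast; ring
  rw [BV.norm_def, BV.norm_def, map_pow]
  refine (ENNReal.toReal_mono (ENNReal.mul_lt_top (ENNReal.pow_lt_top F.supNorm_lt_top)
    (ENNReal.mul_lt_top (ENNReal.natCast_lt_top _) F.bvNorm_lt_top)).ne h).trans ?_
  rw [ENNReal.toReal_mul, ENNReal.toReal_mul, ENNReal.toReal_pow, ENNReal.toReal_natCast]
  push_cast
  exact le_rfl

/-- A bounded character is bounded by the supremum norm. -/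
theorem norm_character_le (φ : AC σ →ₐ[ℂ] ℂ) (hφ : Continuous φ) (F : AC σ) :
    ‖φ F‖ ≤ (supNorm (BV.val σ (F : BV σ))).toReal := by
  let φL : AC σ →L[ℂ] ℂ := ⟨φ.toLinearMap, hφ⟩
  have hb : ∀ G : AC σ, ‖φ G‖ ≤ ‖φL‖ * ‖(G : BV σ)‖ := fun G => φL.le_opNorm G
  set s := (supNorm (BV.val σ (F : BV σ))).toReal with hs
  have hs0 : 0 ≤ s := ENNReal.toReal_nonneg
  by_contra! hlt
  have hpos : 0 < ‖φ F‖ := hs0.trans_lt hlt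
  set r := s / ‖φ F‖ with hr
  have hr0 : 0 ≤ r := by positivity
  have hr1 : r < 1 := (div_lt_one hpos).mpr hlt
  -- Boundedness of `φ` on `F ^ (n + 1)`, divided by `‖φ F‖ ^ n`. The right side tends to 0 because
  -- `r < 1`.
  have hn : ∀ n : ℕ, ‖φ F‖ ≤ ‖φL‖ * ‖(F : BV σ)‖ * ((n + 2) * r ^ n) := fun n => by
    have h1 := hb (F ^ (n + 1))
    rw [map_pow, norm_pow] at h1
    have h2 := mul_le_mul_of_nonneg_left (BV.norm_pow_succ_le (F : BV σ) n) (norm_nonneg φL)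
    have h3 := h1.trans h2
    rw [pow_succ, mul_comm, ← le_div_iff₀ (pow_pos hpos n)] at h3
    refine h3.trans (le_of_eq ?_)
    rw [hr, div_pow, ← hs]
    ring
  have hlim : Filter.Tendsto (fun n : ℕ => ‖φL‖ * ‖(F : BV σ)‖ * ((n + 2) * r ^ n)) Filter.atTop
      (nhds (‖φL‖ * ‖(F : BV σ)‖ * (0 + 2 * 0))) := by
    refine Filter.Tendsto.const_mul _ ?_
    simp only [add_mul]
    exact (tendsto_self_mul_const_pow_of_lt_one hr0 hr1).add
      ((tendsto_pow_atTop_nhds_zero_of_lt_one hr0 hr1).const_mul 2)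
  have := ge_of_tendsto' hlim hn
  linarith

theorem norm_le_of_supNorm_le {φ : AC σ →ₐ[ℂ] ℂ} (hφ : Continuous φ) {F : AC σ} {M : ℝ}
    (hM : 0 ≤ M) (h : ∀ z : σ, ‖BV.val σ (F : BV σ) z‖ ≤ M) : ‖φ F‖ ≤ M := by
  refine (norm_character_le φ hφ F).trans (ENNReal.toReal_le_of_le_ofReal hM ?_)
  refine iSup_le fun z => ?_
  rw [← ofReal_norm]
  exact ENNReal.ofReal_le_ofReal (h z)

theorem exists_ac_eq (hσ : Bornology.IsBounded σ) {f : σ → ℂ} (hf : f ∈ polyFunctions σ) :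
    ∃ F : AC σ, BV.val σ (F : BV σ) = f := by
  obtain ⟨F, hF, h⟩ := polyFunctions_le_acFun hσ hf
  exact ⟨⟨F, hF⟩, h⟩

theorem algHom_add_algebraMap {A : Type*} [CommRing A] [Algebra ℂ A] (φ : A →ₐ[ℂ] ℂ) (x : A)
    (c : ℂ) : φ (x + algebraMap ℂ A c) = φ x + c := by
  rw [map_add, AlgHom.commutes]
  rfl

theorem algHom_quadratic {A : Type*} [CommRing A] [Algebra ℂ A] (φ : A →ₐ[ℂ] ℂ) (x y : A)
    (m p q : ℂ) : φ (algebraMap ℂ A m - ((x - algebraMap ℂ A p) ^ 2 +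
      (y - algebraMap ℂ A q) ^ 2)) = m - ((φ x - p) ^ 2 + (φ y - q) ^ 2) := by
  simp

/-- A bounded character maps real functions to real numbers. -/
theorem character_im_eq_zero {φ : AC σ →ₐ[ℂ] ℂ} (hφ : Continuous φ) {F : AC σ} {M : ℝ}
    {g : σ → ℝ} (hg : ∀ z, BV.val σ (F : BV σ) z = g z) (hM : ∀ z, |g z| ≤ M) :
    (φ F).im = 0 := by
  -- Shifting `F` by an imaginary constant `t * I` changes the squared supremum bound only by `t ^
  -- 2`. The term `2 * t * (φ F).im` on the left would be unbounded in `t` if the imaginary part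
  -- were nonzero.
  have key : ∀ t : ℝ, ((φ F).re) ^ 2 + ((φ F).im + t) ^ 2 ≤ M ^ 2 + t ^ 2 := fun t => by
    have h1 := norm_le_of_supNorm_le hφ (F := F + algebraMap ℂ _ (t * Complex.I))
      (M := √(M ^ 2 + t ^ 2)) (Real.sqrt_nonneg _) fun z => by
        have : BV.val σ ((F + algebraMap ℂ (AC σ) (t * Complex.I) : AC σ) : BV σ) z =
            g z + t * Complex.I := by
          rw [← hg z]; rfl
        rw [this]
        refine Real.le_sqrt_of_sq_le ?_
        rw [Complex.sq_norm, Complex.normSq_add_mul_I]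
        have := sq_le_sq' (abs_le.mp (hM z)).1 (abs_le.mp (hM z)).2
        linarith
    rw [algHom_add_algebraMap] at h1
    have h2 := (sq_le_sq₀ (norm_nonneg _) (Real.sqrt_nonneg _)).mpr h1
    rw [Real.sq_sqrt (by positivity), Complex.sq_norm, Complex.normSq_apply] at h2
    simp at h2
    linarith
  by_contra h0
  have := key ((M ^ 2 + 1) / (φ F).im)
  have e : (φ F).im * ((M ^ 2 + 1) / (φ F).im) = M ^ 2 + 1 := mul_div_cancel₀ _ h0
  nlinarith [sq_nonneg (φ F).re, sq_nonneg (φ F).im, sq_nonneg M]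

/-- Bounded characters of `AC(σ)` are evaluations at points of `σ`. -/
theorem exists_eval_eq_character (hσ : IsCompact σ) (hne : σ.Nonempty) {φ : AC σ →ₐ[ℂ] ℂ}
    (hφ : Continuous φ) : ∃ z : σ, ∀ F : AC σ, φ F = BV.val σ (F : BV σ) z := by
  have hb := hσ.isBounded
  obtain ⟨R, hR⟩ := hb.exists_norm_le
  obtain ⟨X, hX⟩ := exists_ac_eq hb (f := fun z : σ => ((z : ℂ).re : ℂ)) ⟨MvPolynomial.X 0, by simp⟩
  obtain ⟨Y, hY⟩ := exists_ac_eq hb (f := fun z : σ => ((z : ℂ).im : ℂ)) ⟨MvPolynomial.X 1, by simp⟩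
  have hXi : (φ X).im = 0 := character_im_eq_zero hφ (fun z => congrFun hX z) fun z =>
    (Complex.abs_re_le_norm z).trans (hR z z.2)
  have hYi : (φ Y).im = 0 := character_im_eq_zero hφ (fun z => congrFun hY z) fun z =>
    (Complex.abs_im_le_norm z).trans (hR z z.2)
  set p : ℝ := (φ X).re with hp
  set q : ℝ := (φ Y).re with hq
  have eX : φ X = p := Complex.ext (by simp [hp]) (by simp [hXi])
  have eY : φ Y = q := Complex.ext (by simp [hq]) (by simp [hYi])
  let d : ℂ → ℝ := fun z => (z.re - p) ^ 2 + (z.im - q) ^ 2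
  have hd : Continuous d := by fun_prop
  obtain ⟨z₀, hz₀, hmin⟩ := hσ.exists_isMinOn hne hd.continuousOn
  obtain ⟨z₁, hz₁, hmax⟩ := hσ.exists_isMaxOn hne hd.continuousOn
  set M := d z₁ with hM
  have hdle : ∀ z ∈ σ, d z ≤ M := fun z hz => hmax hz
  have hled : ∀ z ∈ σ, d z₀ ≤ d z := fun z hz => hmin hz
  have hd0 : 0 ≤ d z₀ := by positivity
  -- `G` is `M - d`, with values between 0 and `M - d z₀` on `σ`, while `φ G = M`. The supremum
  -- bound forces `d z₀ = 0`, so the point `(p, q)` lies in `σ`, without inverting anything in the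
  -- algebra.
  let G : AC σ := algebraMap ℂ _ (M : ℂ) - ((X - algebraMap ℂ _ (p : ℂ)) ^ 2 +
    (Y - algebraMap ℂ _ (q : ℂ)) ^ 2)
  have hG : ∀ z : σ, BV.val σ (G : BV σ) z = ((M - d z : ℝ) : ℂ) := fun z => by
    have : BV.val σ (G : BV σ) z = (M : ℂ) - ((BV.val σ (X : BV σ) z - p) ^ 2 +
      (BV.val σ (Y : BV σ) z - q) ^ 2) := rfl
    rw [this, hX, hY]
    simp [d]
  have hφG : φ G = M := by
    rw [algHom_quadratic, eX, eY]
    simp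
  have h1 := norm_le_of_supNorm_le hφ (F := G) (M := M - d z₀)
    (sub_nonneg.mpr (hdle z₀ hz₀)) fun z => by
      rw [hG, Complex.norm_real, Real.norm_eq_abs,
        abs_of_nonneg (sub_nonneg.mpr (hdle z z.2))]
      linarith [hled z z.2]
  rw [hφG, Complex.norm_real, Real.norm_eq_abs] at h1
  have h2 : d z₀ = 0 := by linarith [le_abs_self M]
  have hre : z₀.re = p := by nlinarith [sq_nonneg (z₀.re - p), sq_nonneg (z₀.im - q)]
  have him : z₀.im = q := by nlinarith [sq_nonneg (z₀.re - p), sq_nonneg (z₀.im - q)]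
  refine ⟨⟨z₀, hz₀⟩, ?_⟩
  let ev : AC σ →ₐ[ℂ] ℂ := ((Pi.evalAlgHom ℂ (fun _ : σ => ℂ) ⟨z₀, hz₀⟩).comp (BV.val σ)).comp
    (AC σ).val
  have hev : Continuous ev := by
    refine AddMonoidHomClass.continuous_of_bound ev 1 fun F => ?_
    rw [one_mul]
    have h3 := enorm_le_supNorm (BV.val σ (F : BV σ)) ⟨z₀, hz₀⟩
    have h4 : ‖ev F‖ₑ ≤ bvNorm (BV.val σ (F : BV σ)) := h3.trans le_self_add
    have := ENNReal.toReal_mono (F : BV σ).bvNorm_lt_top.ne h4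
    rwa [toReal_enorm] at this
  have hpoly : ∀ P : MvPolynomial (Fin 2) ℂ, φ (MvPolynomial.aeval ![X, Y] P) =
      ev (MvPolynomial.aeval ![X, Y] P) := by
    intro P
    have : φ.comp (MvPolynomial.aeval ![X, Y]) = ev.comp (MvPolynomial.aeval ![X, Y]) := by
      refine MvPolynomial.algHom_ext fun i => ?_
      have e1 : ev X = z₀.re := congrFun hX ⟨z₀, hz₀⟩
      have e2 : ev Y = z₀.im := congrFun hY ⟨z₀, hz₀⟩
      fin_cases i
      · simp [eX, e1, hre]
      · simp [eY, e2, him]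
    exact DFunLike.congr_fun this P
  have hval : ∀ P : MvPolynomial (Fin 2) ℂ, BV.val σ ((MvPolynomial.aeval ![X, Y] P : AC σ) : BV σ) =
      MvPolynomial.aeval ![fun z : σ => ((z : ℂ).re : ℂ), fun z : σ => ((z : ℂ).im : ℂ)] P := by
    intro P
    have : ((BV.val σ).comp (AC σ).val).comp (MvPolynomial.aeval ![X, Y]) = MvPolynomial.aeval
        ![fun z : σ => ((z : ℂ).re : ℂ), fun z : σ => ((z : ℂ).im : ℂ)] := by
      refine MvPolynomial.algHom_ext fun i => ?_
      fin_cases i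
      · simpa using hX
      · simpa using hY
    exact DFunLike.congr_fun this P
  -- Polynomials in `X` and `Y` are dense by definition of `AC σ`, so two continuous characters that
  -- agree on `X` and `Y` coincide.
  have hdense : Dense (range fun P : MvPolynomial (Fin 2) ℂ =>
      (MvPolynomial.aeval ![X, Y] P : AC σ)) := by
    intro F
    rw [closure_subtype]
    refine closure_mono ?_ F.2
    rintro P ⟨p, hp⟩
    exact ⟨_, ⟨p, rfl⟩, BV.val_injective ((hval p).trans hp)⟩
  have heq : (fun F => φ F) = fun F => ev F := Continuous.ext_on hdense hφ hev (by
    rintro _ ⟨P, rfl⟩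
    exact hpoly P)
  exact fun F => congrFun heq F

theorem continuous_val_of_mem_ac (F : AC σ) : Continuous (BV.val σ (F : BV σ)) := by
  have hF : (F : BV σ) ∈ closure (((polyFunctions σ).comap (BV.val σ) : Subalgebra ℂ (BV σ)) :
    Set (BV σ)) := F.2
  have hpc : ∀ p ∈ polyFunctions σ, Continuous p := by
    rintro _ ⟨P, rfl⟩
    induction P using MvPolynomial.induction_on with
    | C c =>
      refine (continuous_const (y := c)).congr fun z => ?_
      exact (congrFun (MvPolynomial.aeval_C (S₁ := σ → ℂ) _ c) z).symm
    | add p q hp hq => simpa using hp.add hq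
    | mul_X p i hp =>
      have hi : Continuous ((![fun z : σ => ((z : ℂ).re : ℂ), fun z : σ => ((z : ℂ).im : ℂ)] :
          Fin 2 → σ → ℂ) i) := by
        fin_cases i
        · exact Complex.continuous_ofReal.comp (Complex.continuous_re.comp continuous_subtype_val)
        · exact Complex.continuous_ofReal.comp (Complex.continuous_im.comp continuous_subtype_val)
      rw [map_mul]
      exact hp.mul (hi.congr fun z => (congrFun (MvPolynomial.aeval_X (S₁ := σ → ℂ) _ i) z).symm)
  refine continuous_of_uniform_approx_of_continuous fun u hu => ?_
  obtain ⟨ε, hε, hεu⟩ := Metric.mem_uniformity_dist.mp hu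
  obtain ⟨P, hP, hFP⟩ := Metric.mem_closure_iff.mp hF ε hε
  refine ⟨BV.val σ P, hpc _ hP, fun z => hεu ?_⟩
  rw [dist_eq_norm] at hFP ⊢
  have h1 := (enorm_le_supNorm (BV.val σ ((F : BV σ) - P)) z).trans
    (le_self_add (b := var (BV.val σ ((F : BV σ) - P))))
  have h2 := ENNReal.toReal_mono ((F : BV σ) - P).bvNorm_lt_top.ne h1
  rw [toReal_enorm] at h2
  exact h2.trans_lt hFP

/-- An isomorphism is composition with a continuous map. -/
theorem exists_continuous_of_algEquiv (hσ : IsCompact σ) (hne : σ.Nonempty)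
    (Φ : AC σ ≃A[ℂ] AC τ) : ∃ h : τ → σ, Continuous h ∧ ∀ (F : AC σ) (w : τ),
      BV.val τ (Φ F : BV τ) w = BV.val σ (F : BV σ) (h w) := by
  have hchar : ∀ w : τ, ∃ z : σ, ∀ F : AC σ, BV.val τ (Φ F : BV τ) w = BV.val σ (F : BV σ) z := by
    intro w
    let ev : AC τ →ₐ[ℂ] ℂ := ((Pi.evalAlgHom ℂ (fun _ : τ => ℂ) w).comp (BV.val τ)).comp
      (AC τ).val
    have hev : Continuous ev := by
      refine AddMonoidHomClass.continuous_of_bound ev 1 fun F => ?_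
      rw [one_mul]
      have h3 := enorm_le_supNorm (BV.val τ (F : BV τ)) w
      have h4 : ‖ev F‖ₑ ≤ bvNorm (BV.val τ (F : BV τ)) := h3.trans le_self_add
      have := ENNReal.toReal_mono (F : BV τ).bvNorm_lt_top.ne h4
      rwa [toReal_enorm] at this
    exact exists_eval_eq_character hσ hne (φ := ev.comp (Φ : AC σ →ₐ[ℂ] AC τ))
      (hev.comp Φ.continuous)
  choose h hh using hchar
  refine ⟨h, ?_, fun F w => hh w F⟩
  -- For the inclusion `Z` of `σ` in the plane, `Φ Z` is the map `h` itself, and elements of `AC τ`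
  -- are continuous.
  obtain ⟨Z, hZ⟩ := exists_ac_eq hσ.isBounded (polynomial_complex_mem (σ := σ) Polynomial.X)
  refine continuous_induced_rng.mpr ((continuous_val_of_mem_ac (Φ Z)).congr fun w => ?_)
  rw [hh, hZ]
  simp

/-- The point maps of `Φ` and `Φ.symm` are inverse to each other because the inclusion into the
plane belongs to both algebras and separates points. -/
theorem nonempty_homeomorph_of_algEquiv (hσ : IsCompact σ) (hσn : σ.Nonempty) (hτ : IsCompact τ)
    (hτn : τ.Nonempty) (Φ : AC σ ≃A[ℂ] AC τ) : Nonempty (σ ≃ₜ τ) := by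
  obtain ⟨h, hc, hh⟩ := exists_continuous_of_algEquiv hσ hσn Φ
  obtain ⟨g, gc, hg⟩ := exists_continuous_of_algEquiv hτ hτn Φ.symm
  refine ⟨{ toFun := g, invFun := h, left_inv := fun z => ?_, right_inv := fun w => ?_,
            continuous_toFun := gc, continuous_invFun := hc }⟩
  · obtain ⟨Z, hZ⟩ := exists_ac_eq hσ.isBounded (polynomial_complex_mem (σ := σ) Polynomial.X)
    have := hg (Φ Z) z
    rw [Φ.symm_apply_apply, hh, hZ] at this
    simpa using (Subtype.ext (by simpa using this)).symm
  · obtain ⟨Z, hZ⟩ := exists_ac_eq hτ.isBounded (polynomial_complex_mem (σ := τ) Polynomial.X)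
    have := hh (Φ.symm Z) w
    rw [Φ.apply_symm_apply, hg, hZ] at this
    simpa using (Subtype.ext (by simpa using this)).symm

end Characters

/-! ### Graph structures and their transport by homeomorphisms. -/

section Graph

variable {ι ι' : Type*} {σ τ V W : Set ℂ} {a b : ι → ℂ} {c d : ι' → ℂ}

/-- `σ` is a graph with finite vertex set `V` and the open segments `(a i, b i)` as edges. -/
structure IsGraph (σ V : Set ℂ) (a b : ι → ℂ) : Prop where
  finite : V.Finite
  left_mem : ∀ i, a i ∈ V
  right_mem : ∀ i, b i ∈ V
  ne : ∀ i, a i ≠ b i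
  cover : σ = V ∪ ⋃ i, openSegment ℝ (a i) (b i)
  disjoint_vertices : ∀ i, Disjoint (openSegment ℝ (a i) (b i)) V
  disjoint_edges : ∀ i j, i ≠ j → Disjoint (openSegment ℝ (a i) (b i)) (openSegment ℝ (a j) (b j))

theorem IsGraph.vertices_subset (h : IsGraph σ V a b) : V ⊆ σ := by
  rw [h.cover]; exact subset_union_left

theorem IsGraph.edge_subset (h : IsGraph σ V a b) (i : ι) : openSegment ℝ (a i) (b i) ⊆ σ := by
  rw [h.cover]; exact subset_union_of_subset_right
    (subset_iUnion (fun i => openSegment ℝ (a i) (b i)) i) _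

theorem IsGraph.mem_or (h : IsGraph σ V a b) {z : ℂ} (hz : z ∈ σ) :
    z ∈ V ∨ ∃ i, z ∈ openSegment ℝ (a i) (b i) := by
  rcases h.cover.subset hz with hz | hz
  · exact Or.inl hz
  · exact Or.inr (mem_iUnion.mp hz)

theorem openSegment_nonempty (p q : ℂ) : (openSegment ℝ p q).Nonempty :=
  ⟨_, mem_openSegment_iff_lineMap.mpr ⟨1 / 2, by norm_num, rfl⟩⟩

theorem IsGraph.disjoint_edge_segment (h : IsGraph σ V a b) {i j : ι} (hij : i ≠ j) :
    Disjoint (openSegment ℝ (a i) (b i)) (segment ℝ (a j) (b j)) := by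
  refine disjoint_left.mpr fun z hz hz' => ?_
  rcases mem_openSegment_or_eq hz' with rfl | rfl | hz'
  · exact disjoint_left.mp (h.disjoint_vertices i) hz (h.left_mem j)
  · exact disjoint_left.mp (h.disjoint_vertices i) hz (h.right_mem j)
  · exact disjoint_left.mp (h.disjoint_edges i j hij) hz hz'

/-- Vertices enter as one-point cells, so a vertex without edges is covered too. -/
theorem IsGraph.isCellDecomp (h : IsGraph σ V a b) :
    IsCellDecomp σ (Sum.elim ((↑) : V → ℂ) a) (Sum.elim ((↑) : V → ℂ) b) where
  cover := by
    ext z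
    rw [mem_iUnion]
    constructor
    · intro hz
      rcases h.mem_or hz with hz | ⟨i, hz⟩
      · exact ⟨Sum.inl ⟨z, hz⟩, by simp⟩
      · exact ⟨Sum.inr i, openSegment_subset_segment _ _ _ hz⟩
    · rintro ⟨v | i, hz⟩
      · rw [Sum.elim_inl, Sum.elim_inl, segment_same] at hz
        exact h.vertices_subset (mem_singleton_iff.mp hz ▸ v.2)
      · rcases mem_openSegment_or_eq hz with rfl | rfl | hz
        · exact h.vertices_subset (h.left_mem i)
        · exact h.vertices_subset (h.right_mem i)
        · exact h.edge_subset i hz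
  disj := by
    rintro (v | i) (w | j) hij hne
    · exact absurd rfl hne
    · exact absurd rfl hne
    · simp only [Sum.elim_inl, Sum.elim_inr, segment_same, disjoint_singleton_right]
      exact disjoint_right.mp (h.disjoint_vertices i) w.2
    · exact h.disjoint_edge_segment fun e => hij (congrArg _ e)

theorem IsCellDecomp.comp_equiv {κ κ' : Type*} {a b : κ → ℂ} (h : IsCellDecomp σ a b)
    (e : κ' ≃ κ) : IsCellDecomp σ (a ∘ e) (b ∘ e) where
  cover := h.cover.trans (e.surjective.iUnion_comp fun i => segment ℝ (a i) (b i)).symm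
  disj i j hij hi := h.disj (e i) (e j) (fun h => hij (e.injective h)) hi

/-- Two open segments on a common line that meet but do not contain end points of one another
are equal. -/
theorem openSegment_eq_of_inter {T : Set ℂ} {z₁ z₂ p q r s z : ℂ} (hz : z₁ ≠ z₂)
    (hp : p ∈ range (AffineMap.lineMap z₁ z₂ : ℝ → ℂ))
    (hq : q ∈ range (AffineMap.lineMap z₁ z₂ : ℝ → ℂ))
    (hr : r ∈ range (AffineMap.lineMap z₁ z₂ : ℝ → ℂ))
    (hs : s ∈ range (AffineMap.lineMap z₁ z₂ : ℝ → ℂ))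
    (hpq : p ≠ q) (hrs : r ≠ s) (hpT : p ∈ T) (hqT : q ∈ T) (hrT : r ∈ T) (hsT : s ∈ T)
    (h1 : Disjoint (openSegment ℝ p q) T) (h2 : Disjoint (openSegment ℝ r s) T)
    (hz1 : z ∈ openSegment ℝ p q) (hz2 : z ∈ openSegment ℝ r s) :
    openSegment ℝ p q = openSegment ℝ r s := by
  have hinj : Function.Injective (AffineMap.lineMap z₁ z₂ : ℝ → ℂ) :=
    AffineMap.lineMap_injective ℝ hz
  have key : ∀ p q : ℂ, p ∈ range (AffineMap.lineMap z₁ z₂ : ℝ → ℂ) →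
      q ∈ range (AffineMap.lineMap z₁ z₂ : ℝ → ℂ) → p ∈ T → q ∈ T →
      ∃ x y : ℝ, AffineMap.lineMap z₁ z₂ x ∈ T ∧ AffineMap.lineMap z₁ z₂ y ∈ T ∧
        openSegment ℝ p q = AffineMap.lineMap z₁ z₂ '' Ioo x y ∨ p = q := by
    rintro _ _ ⟨x, rfl⟩ ⟨y, rfl⟩ hp hq
    have e := image_openSegment ℝ (AffineMap.lineMap z₁ z₂ : ℝ →ᵃ[ℝ] ℂ) x y
    rcases lt_trichotomy x y with hxy | hxy | hxy
    · exact ⟨x, y, Or.inl ⟨hp, hq, by rw [← e, openSegment_eq_Ioo hxy]⟩⟩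
    · exact ⟨x, y, Or.inr (by rw [hxy])⟩
    · exact ⟨y, x, Or.inl ⟨hq, hp, by rw [← e, openSegment_symm, openSegment_eq_Ioo hxy]⟩⟩
  obtain ⟨x, y, hxy⟩ := key p q hp hq hpT hqT
  obtain ⟨hx, hy, e1⟩ := hxy.resolve_right hpq
  obtain ⟨x', y', hxy'⟩ := key r s hr hs hrT hsT
  obtain ⟨hx', hy', e2⟩ := hxy'.resolve_right hrs
  rw [e1] at hz1 h1 ⊢
  rw [e2] at hz2 h2 ⊢
  obtain ⟨t, ht, rfl⟩ := hz1
  obtain ⟨t', ht', htt'⟩ := hz2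
  obtain rfl := hinj htt'
  -- Two real intervals that share a point, with no end of either inside the other, are equal.
  have n1 : x' ∉ Ioo x y := fun hm => disjoint_left.mp h1 (mem_image_of_mem _ hm) hx'
  have n2 : y' ∉ Ioo x y := fun hm => disjoint_left.mp h1 (mem_image_of_mem _ hm) hy'
  have n3 : x ∉ Ioo x' y' := fun hm => disjoint_left.mp h2 (mem_image_of_mem _ hm) hx
  have n4 : y ∉ Ioo x' y' := fun hm => disjoint_left.mp h2 (mem_image_of_mem _ hm) hy
  have ex : x = x' := by
    refine le_antisymm ?_ ?_
    · by_contra! hlt; exact n3 ⟨hlt, ht.1.trans ht'.2⟩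
    · by_contra! hlt; exact n1 ⟨hlt, ht'.1.trans ht.2⟩
  have ey : y = y' := by
    refine le_antisymm ?_ ?_
    · by_contra! hlt; exact n2 ⟨ht.1.trans ht'.2, hlt⟩
    · by_contra! hlt; exact n4 ⟨ht'.1.trans ht.2, hlt⟩
  rw [ex, ey]

theorem segment_subset_range_lineMap {p q z₁ z₂ : ℂ} (hz : z₁ ≠ z₂) (h1 : z₁ ∈ segment ℝ p q)
    (h2 : z₂ ∈ segment ℝ p q) : segment ℝ p q ⊆ range (AffineMap.lineMap z₁ z₂ : ℝ → ℂ) := by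
  obtain ⟨t₁, -, rfl⟩ := mem_segment_iff_lineMap.mp h1
  obtain ⟨t₂, -, rfl⟩ := mem_segment_iff_lineMap.mp h2
  rintro z hz'
  obtain ⟨t, -, rfl⟩ := mem_segment_iff_lineMap.mp hz'
  have hne : (t₂ : ℂ) - t₁ ≠ 0 := by
    intro h0
    have : t₂ = t₁ := by exact_mod_cast sub_eq_zero.mp h0
    exact hz (by rw [this])
  refine ⟨(t - t₁) / (t₂ - t₁), ?_⟩
  simp only [lineMap_eq_add]
  push_cast
  field_simp
  ring

/-- A finite union of segments is a graph with vertex set `V` for all sufficiently large finite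
subsets `V`. -/
theorem exists_isGraph {T : Set (ℂ × ℂ)} (hT : T.Finite) (hσ : σ = ⋃ p ∈ T, segment ℝ p.1 p.2) :
    ∃ V₀ : Set ℂ, V₀.Finite ∧ V₀ ⊆ σ ∧ ∀ V : Set ℂ, V.Finite → V₀ ⊆ V → V ⊆ σ →
      ∃ (ι : Type) (a b : ι → ℂ), Finite ι ∧ IsGraph σ V a b := by
  let S : ℂ × ℂ → Set ℂ := fun p => segment ℝ p.1 p.2
  have hSσ : ∀ p ∈ T, S p ⊆ σ := fun p hp => by
    rw [hσ]; exact subset_biUnion_of_mem (u := S) hp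
  -- Intersections with at most one point become vertices. Overlaps in more than one point occur
  -- only between collinear segments, whose end points are vertices anyway.
  let X : Set ℂ := ⋃ r ∈ {r : (ℂ × ℂ) × (ℂ × ℂ) | r ∈ T ×ˢ T ∧ (S r.1 ∩ S r.2).Subsingleton},
    S r.1 ∩ S r.2
  refine ⟨Prod.fst '' T ∪ Prod.snd '' T ∪ X, ?_, ?_, ?_⟩
  · refine ((hT.image _).union (hT.image _)).union ?_
    refine Finite.biUnion ((hT.prod hT).subset fun r hr => hr.1) fun r hr => hr.2.finite
  · refine union_subset (union_subset ?_ ?_) ?_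
    · rintro _ ⟨p, hp, rfl⟩
      exact hSσ p hp (left_mem_segment _ _ _)
    · rintro _ ⟨p, hp, rfl⟩
      exact hSσ p hp (right_mem_segment _ _ _)
    · exact iUnion₂_subset fun r hr => inter_subset_left.trans (hSσ _ hr.1.1)
  intro V hV hV₀ hVσ
  have hV1 : ∀ p ∈ T, p.1 ∈ V := fun p hp => hV₀ (Or.inl (Or.inl ⟨p, hp, rfl⟩))
  have hV2 : ∀ p ∈ T, p.2 ∈ V := fun p hp => hV₀ (Or.inl (Or.inr ⟨p, hp, rfl⟩))
  have hVX : ∀ p ∈ T, ∀ q ∈ T, ∀ z ∈ S p ∩ S q, z ∉ V → ¬ (S p ∩ S q).Subsingleton :=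
    fun p hp q hq z hz hzV hsub =>
      hzV (hV₀ (Or.inr (mem_biUnion (x := (p, q)) ⟨⟨hp, hq⟩, hsub⟩ hz)))
  -- Edges are point sets, so an edge lying on several segments, or read in either direction, is
  -- counted once.
  let ℰ : Set (Set ℂ) := {s | ∃ a ∈ V, ∃ b ∈ V, a ≠ b ∧ s = openSegment ℝ a b ∧ Disjoint s V ∧
    ∃ p ∈ T, segment ℝ a b ⊆ S p}
  have hfin : ℰ.Finite := by
    refine (hV.image2 (openSegment ℝ) hV).subset ?_
    rintro s ⟨a, ha, b, hb, -, rfl, -⟩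
    exact ⟨a, ha, b, hb, rfl⟩
  choose a ha b hb hab hs hdis p hp hsub using fun s : ℰ => s.2
  refine ⟨ℰ, a, b, hfin.to_subtype, hV, ha, hb, hab, ?_, fun s => hs s ▸ hdis s, ?_⟩
  · refine Subset.antisymm (fun z hz => ?_) (union_subset hVσ (iUnion_subset fun s =>
      (openSegment_subset_segment _ _ _).trans ((hsub s).trans (hSσ _ (hp s)))))
    by_cases hzV : z ∈ V
    · exact Or.inl hzV
    refine Or.inr ?_
    rw [hσ] at hz
    obtain ⟨q, hq, hz⟩ := mem_iUnion₂.mp hz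
    have hq12 : q.1 ≠ q.2 := fun e => by
      rw [← e, segment_same, mem_singleton_iff] at hz
      exact hzV (hz ▸ hV1 q hq)
    obtain ⟨t₀, ht₀, rfl⟩ := mem_segment_iff_lineMap.mp hz
    have hinj : Function.Injective (AffineMap.lineMap q.1 q.2 : ℝ → ℂ) :=
      AffineMap.lineMap_injective ℝ hq12
    let A : Set ℝ := {t | t ∈ Icc (0 : ℝ) 1 ∧ (AffineMap.lineMap q.1 q.2 t : ℂ) ∈ V}
    have hA : A.Finite := (hV.preimage hinj.injOn).subset fun t ht => ht.2
    -- The nearest vertices on either side of the point along the segment bound its edge.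
    obtain ⟨α, hα, hαm⟩ := exists_max_image (A ∩ Iic t₀) id (hA.inter_of_left _)
      ⟨0, ⟨⟨le_rfl, zero_le_one⟩, by simpa using hV1 q hq⟩, ht₀.1⟩
    obtain ⟨β, hβ, hβm⟩ := exists_min_image (A ∩ Ici t₀) id (hA.inter_of_left _)
      ⟨1, ⟨⟨zero_le_one, le_rfl⟩, by simpa using hV2 q hq⟩, ht₀.2⟩
    have hαt : α < t₀ := lt_of_le_of_ne hα.2 fun e => hzV (e ▸ hα.1.2)
    have htβ : t₀ < β := lt_of_le_of_ne hβ.2 fun e => hzV (e ▸ hβ.1.2)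
    have e : openSegment ℝ (AffineMap.lineMap q.1 q.2 α : ℂ) (AffineMap.lineMap q.1 q.2 β) =
        AffineMap.lineMap q.1 q.2 '' Ioo α β := by
      rw [← openSegment_eq_Ioo (hαt.trans htβ)]
      exact (image_openSegment ℝ (AffineMap.lineMap q.1 q.2 : ℝ →ᵃ[ℝ] ℂ) α β).symm
    have hmem : AffineMap.lineMap q.1 q.2 '' Ioo α β ∈ ℰ := by
      refine ⟨_, hα.1.2, _, hβ.1.2, fun h => (hαt.trans htβ).ne (hinj h), e.symm, ?_, q, hq, ?_⟩
      · refine disjoint_left.mpr ?_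
        rintro _ ⟨t, ht, rfl⟩ htV
        have htA : t ∈ A := ⟨⟨hα.1.1.1.trans ht.1.le, ht.2.le.trans hβ.1.1.2⟩, htV⟩
        rcases le_total t t₀ with hle | hle
        · exact absurd (hαm t ⟨htA, hle⟩) (not_le.mpr ht.1)
        · exact absurd (hβm t ⟨htA, hle⟩) (not_le.mpr ht.2)
      · exact (convex_segment q.1 q.2).segment_subset
          (mem_segment_iff_lineMap.mpr ⟨α, hα.1.1, rfl⟩)
          (mem_segment_iff_lineMap.mpr ⟨β, hβ.1.1, rfl⟩)
    refine mem_iUnion.mpr ⟨⟨_, hmem⟩, ?_⟩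
    rw [← hs ⟨_, hmem⟩]
    exact ⟨t₀, ⟨hαt, htβ⟩, rfl⟩
  · intro s s' hss'
    by_contra hnd
    obtain ⟨z, hz, hz'⟩ := not_disjoint_iff.mp hnd
    have hzV : z ∉ V := disjoint_left.mp (hdis s) (by rw [hs s]; exact hz)
    -- Two edges meeting at a non-vertex lie on segments sharing at least two points, hence on one
    -- line, where they must coincide.
    have hns := hVX _ (hp s) _ (hp s') z ⟨hsub s (openSegment_subset_segment _ _ _ hz),
      hsub s' (openSegment_subset_segment _ _ _ hz')⟩ hzV
    obtain ⟨z₁, h₁, z₂, h₂, hne⟩ := not_subsingleton_iff.mp hns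
    have hr := (hsub s).trans (segment_subset_range_lineMap hne h₁.1 h₂.1)
    have hr' := (hsub s').trans (segment_subset_range_lineMap hne h₁.2 h₂.2)
    refine hss' (Subtype.ext ?_)
    rw [hs s, hs s']
    exact openSegment_eq_of_inter hne (hr (left_mem_segment _ _ _)) (hr (right_mem_segment _ _ _))
      (hr' (left_mem_segment _ _ _)) (hr' (right_mem_segment _ _ _)) (hab s) (hab s') (ha s)
      (hb s) (ha s') (hb s') (hs s ▸ hdis s) (hs s' ▸ hdis s') hz hz'

/-- A homeomorphism respecting the vertices maps edges into edges. -/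
theorem IsGraph.exists_edge_mapsTo [Finite ι'] (h : IsGraph σ V a b) (h' : IsGraph τ W c d)
    (f : σ ≃ₜ τ) (hf : ∀ z : σ, (z : ℂ) ∈ V ↔ (f z : ℂ) ∈ W) (i : ι) :
    ∃ j, ∀ z : σ, (z : ℂ) ∈ openSegment ℝ (a i) (b i) → (f z : ℂ) ∈ openSegment ℝ (c j) (d j) := by
  let A : Set σ := (↑) ⁻¹' openSegment ℝ (a i) (b i)
  have hAi : (↑) '' A = openSegment ℝ (a i) (b i) := by
    rw [Subtype.image_preimage_coe, inter_eq_right.mpr (h.edge_subset i)]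
  have hA : IsPreconnected A := by
    rw [← Topology.IsInducing.subtypeVal.isPreconnected_image, hAi]
    exact (convex_openSegment _ _).isPreconnected
  have hfA : IsPreconnected (f '' A) := hA.image _ f.continuous.continuousOn
  have hW : ∀ z ∈ A, (f z : ℂ) ∉ W := fun z hz hzW =>
    disjoint_left.mp (h.disjoint_vertices i) hz ((hf z).mpr hzW)
  obtain ⟨z₀, hz₀⟩ : A.Nonempty := by
    obtain ⟨z, hz⟩ := openSegment_nonempty (a i) (b i)
    exact ⟨⟨z, h.edge_subset i hz⟩, hz⟩
  obtain ⟨j, hj⟩ := (h'.mem_or (f z₀).2).resolve_left (hW z₀ hz₀)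
  refine ⟨j, fun z hz => ?_⟩
  have hseg : ∀ p q : ℂ, IsClosed (segment ℝ p q) := fun p q => by
    rw [← closure_openSegment]; exact isClosed_closure
  let u : Set τ := (↑) ⁻¹' openSegment ℝ (c j) (d j)
  let v : Set τ := (↑) ⁻¹' (segment ℝ (c j) (d j))ᶜ
  -- An open edge is relatively open, being the complement of finitely many closed pieces. The
  -- connected image avoids `W`, in particular the ends of this edge, so it cannot leave the edge.
  have hu : IsOpen u := by
    have : u = (↑) ⁻¹' (W ∪ ⋃ k : {k // k ≠ j}, segment ℝ (c k) (d k))ᶜ := by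
      ext w
      simp only [u, mem_preimage, mem_compl_iff, mem_union, mem_iUnion, not_or, not_exists]
      constructor
      · intro hw
        exact ⟨disjoint_left.mp (h'.disjoint_vertices j) hw, fun k =>
          disjoint_left.mp (h'.disjoint_edge_segment k.2.symm) hw⟩
      · rintro ⟨h1, h2⟩
        obtain ⟨k, hk⟩ := (h'.mem_or w.2).resolve_left h1
        by_cases hkj : k = j
        · exact hkj ▸ hk
        · exact absurd (openSegment_subset_segment _ _ _ hk) (h2 ⟨k, hkj⟩)
    rw [this]
    exact (h'.finite.isClosed.union (isClosed_iUnion_of_finite fun k =>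
      hseg _ _)).isOpen_compl.preimage continuous_subtype_val
  have hv : IsOpen v := (hseg _ _).isOpen_compl.preimage continuous_subtype_val
  refine (hfA.subset_left_of_subset_union hu hv ?_ ?_ ⟨f z₀, ⟨z₀, hz₀, rfl⟩, hj⟩ :
    f '' A ⊆ u) ⟨z, hz, rfl⟩
  · exact disjoint_left.mpr fun w hw hw' => hw' (openSegment_subset_segment _ _ _ hw)
  · rintro _ ⟨w, hw, rfl⟩
    by_cases hws : (f w : ℂ) ∈ segment ℝ (c j) (d j)
    · rcases mem_openSegment_or_eq hws with e | e | e
      · exact absurd (e ▸ h'.left_mem j) (hW w hw)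
      · exact absurd (e ▸ h'.right_mem j) (hW w hw)
      · exact Or.inl e
    · exact Or.inr hws

/-- A homeomorphism respecting the vertices transports the graph structure. -/
theorem IsGraph.map [Finite ι] [Finite ι'] (h : IsGraph σ V a b) (h' : IsGraph τ W c d)
    (f : σ ≃ₜ τ) (hf : ∀ z : σ, (z : ℂ) ∈ V ↔ (f z : ℂ) ∈ W) :
    IsGraph τ W (fun i => (f ⟨a i, h.vertices_subset (h.left_mem i)⟩ : ℂ))
      (fun i => (f ⟨b i, h.vertices_subset (h.right_mem i)⟩ : ℂ)) := by
  choose π hπ using fun i => h.exists_edge_mapsTo h' f hf i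
  choose ρ hρ using fun j => h'.exists_edge_mapsTo h f.symm (fun w => by rw [hf]; simp) j
  have hρπ : ∀ i, ρ (π i) = i := fun i => by
    obtain ⟨z, hz⟩ := openSegment_nonempty (a i) (b i)
    have h1 := hρ _ _ (hπ i ⟨z, h.edge_subset i hz⟩ hz)
    rw [f.symm_apply_apply] at h1
    by_contra hne
    exact disjoint_left.mp (h.disjoint_edges _ _ hne) h1 hz
  have hπρ : ∀ j, π (ρ j) = j := fun j => by
    obtain ⟨z, hz⟩ := openSegment_nonempty (c j) (d j)
    have h1 := hπ _ _ (hρ j ⟨z, h'.edge_subset j hz⟩ hz)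
    rw [f.apply_symm_apply] at h1
    by_contra hne
    exact disjoint_left.mp (h'.disjoint_edges _ _ hne) h1 hz
  -- By continuity an end of an edge goes to the closure of the image edge, and being a vertex it
  -- goes to one of its ends. The orientation may be reversed, which leaves the open segment
  -- unchanged.
  have hend : ∀ i, ∀ z : σ, (z : ℂ) ∈ segment ℝ (a i) (b i) → (z : ℂ) ∈ V →
      (f z : ℂ) = c (π i) ∨ (f z : ℂ) = d (π i) := by
    intro i z hz hzV
    have h1 : z ∈ closure ((↑) ⁻¹' openSegment ℝ (a i) (b i) : Set σ) := by
      rw [closure_subtype, Subtype.image_preimage_coe, inter_eq_right.mpr (h.edge_subset i),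
        closure_openSegment]
      exact hz
    have h2 := map_mem_closure (t := (openSegment ℝ (c (π i)) (d (π i))))
      (continuous_subtype_val.comp f.continuous) h1 (hπ i)
    rw [closure_openSegment] at h2
    rcases mem_openSegment_or_eq h2 with e | e | e
    · exact Or.inl e
    · exact Or.inr e
    · exact absurd ((hf z).mp hzV) (disjoint_left.mp (h'.disjoint_vertices _) e)
  have hne : ∀ i, (f ⟨a i, h.vertices_subset (h.left_mem i)⟩ : ℂ) ≠
      f ⟨b i, h.vertices_subset (h.right_mem i)⟩ := fun i e =>
    h.ne i (congrArg Subtype.val (f.injective (Subtype.ext e)))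
  have hseg : ∀ i, openSegment ℝ (f ⟨a i, h.vertices_subset (h.left_mem i)⟩ : ℂ)
      (f ⟨b i, h.vertices_subset (h.right_mem i)⟩) = openSegment ℝ (c (π i)) (d (π i)) := by
    intro i
    have hn := hne i
    rcases hend i ⟨a i, h.vertices_subset (h.left_mem i)⟩ (left_mem_segment _ _ _) (h.left_mem i)
      with e1 | e1 <;>
    rcases hend i ⟨b i, h.vertices_subset (h.right_mem i)⟩ (right_mem_segment _ _ _)
      (h.right_mem i) with e2 | e2
    · exact absurd (e1.trans e2.symm) hn
    · rw [e1, e2]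
    · rw [e1, e2, openSegment_symm]
    · exact absurd (e1.trans e2.symm) hn
  refine ⟨h'.finite, fun i => (hf _).mp (h.left_mem i), fun i => (hf _).mp (h.right_mem i), hne,
    ?_, fun i => by rw [hseg]; exact h'.disjoint_vertices _, fun i j hij => ?_⟩
  · refine h'.cover.trans ?_
    simp only [hseg]
    congr 1
    exact ((Function.LeftInverse.surjective hπρ).iUnion_comp
      (fun j => openSegment ℝ (c j) (d j))).symm
  · rw [hseg, hseg]
    exact h'.disjoint_edges _ _ fun e => hij (by rw [← hρπ i, e, hρπ])

variable {a' b' : ι → ℂ}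

/-- Corresponding points of two graphs with the same combinatorial structure. -/
def GraphRel (a b a' b' : ι → ℂ) (e : V ≃ W) (z w : ℂ) : Prop :=
  (∃ v : V, z = v ∧ w = e v) ∨
    ∃ i, ∃ t ∈ Ioo (0 : ℝ) 1, z = AffineMap.lineMap (a i) (b i) t ∧
      w = AffineMap.lineMap (a' i) (b' i) t

theorem GraphRel.symm {e : V ≃ W} {z w : ℂ} (h : GraphRel a b a' b' e z w) :
    GraphRel a' b' a b e.symm w z := by
  rcases h with ⟨v, hz, hw⟩ | ⟨i, t, ht, hz, hw⟩
  · exact Or.inl ⟨e v, hw, by simpa using hz⟩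
  · exact Or.inr ⟨i, t, ht, hw, hz⟩

theorem IsGraph.exists_graphRel (h : IsGraph σ V a b) (h' : IsGraph τ W a' b') (e : V ≃ W)
    (z : σ) : ∃ w : τ, GraphRel a b a' b' e z w := by
  rcases h.mem_or z.2 with hz | ⟨i, hz⟩
  · exact ⟨⟨e ⟨z, hz⟩, h'.vertices_subset (e ⟨z, hz⟩).2⟩, Or.inl ⟨⟨z, hz⟩, rfl, rfl⟩⟩
  · obtain ⟨t, ht, hz⟩ := mem_openSegment_iff_lineMap.mp hz
    exact ⟨⟨_, h'.edge_subset i (mem_openSegment_iff_lineMap.mpr ⟨t, ht, rfl⟩)⟩,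
      Or.inr ⟨i, t, ht, hz, rfl⟩⟩

/-- A point is a vertex or an interior point of exactly one edge with one parameter. With
`GraphRel.symm` this makes the relation a bijection. -/
theorem IsGraph.graphRel_unique (h : IsGraph σ V a b) {e : V ≃ W} {z w w' : ℂ}
    (hw : GraphRel a b a' b' e z w) (hw' : GraphRel a b a' b' e z w') : w = w' := by
  rcases hw with ⟨v, hz, rfl⟩ | ⟨i, t, ht, hz, rfl⟩ <;>
  rcases hw' with ⟨v', hz', rfl⟩ | ⟨i', t', ht', hz', rfl⟩
  · rw [Subtype.ext (hz.symm.trans hz')]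
  · exact absurd (hz ▸ v.2) (disjoint_left.mp (h.disjoint_vertices i')
      (mem_openSegment_iff_lineMap.mpr ⟨t', ht', hz'⟩))
  · exact absurd (hz' ▸ v'.2) (disjoint_left.mp (h.disjoint_vertices i)
      (mem_openSegment_iff_lineMap.mpr ⟨t, ht, hz⟩))
  · have hi : i = i' := by
      by_contra hne
      exact disjoint_left.mp (h.disjoint_edges _ _ hne)
        (mem_openSegment_iff_lineMap.mpr ⟨t, ht, hz⟩)
        (mem_openSegment_iff_lineMap.mpr ⟨t', ht', hz'⟩)
    subst hi
    rw [AffineMap.lineMap_injective ℝ (h.ne i) (hz.symm.trans hz')]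

/-- Graphs with the same combinatorial structure are related by a bijection that is affine on
the cells. -/
theorem IsGraph.exists_isCellAffine (h : IsGraph σ V a b) (h' : IsGraph τ W a' b') (e : V ≃ W)
    (ha : ∀ i, a' i = e ⟨a i, h.left_mem i⟩) (hb : ∀ i, b' i = e ⟨b i, h.right_mem i⟩) :
    ∃ k : σ ≃ τ, IsCellAffine (Sum.elim ((↑) : V → ℂ) a) (Sum.elim ((↑) : V → ℂ) b)
      (Sum.elim (fun v => (e v : ℂ)) a') (Sum.elim (fun v => (e v : ℂ)) b') k := by
  choose k hk using h.exists_graphRel h' e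
  choose g hg using h'.exists_graphRel h e.symm
  have huniq : ∀ {z : σ} {w : ℂ}, GraphRel a b a' b' e z w → (k z : ℂ) = w := fun hzw =>
    h.graphRel_unique (hk _) hzw
  refine ⟨⟨k, g, fun z => ?_, fun w => ?_⟩, ?_⟩
  · exact Subtype.ext (h'.graphRel_unique (hg (k z)) (hk z).symm)
  · exact Subtype.ext (huniq (hg w).symm)
  · rintro (v | i) z t ht hz
    · refine huniq (Or.inl ⟨v, ?_, ?_⟩)
      · simpa using hz
      · simp
    · change (k z : ℂ) = _
      simp only [Sum.elim_inr] at hz ⊢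
      rcases eq_or_ne t 0 with rfl | h0
      · refine huniq (Or.inl ⟨⟨a i, h.left_mem i⟩, by simpa using hz, ?_⟩)
        rw [AffineMap.lineMap_apply_zero, ha]
      rcases eq_or_ne t 1 with rfl | h1
      · refine huniq (Or.inl ⟨⟨b i, h.right_mem i⟩, by simpa using hz, ?_⟩)
        rw [AffineMap.lineMap_apply_one, hb]
      · exact huniq (Or.inr ⟨i, t, ⟨lt_of_le_of_ne ht.1 h0.symm, lt_of_le_of_ne ht.2 h1⟩, hz, rfl⟩)

/-- Homeomorphic linear graphs have isomorphic algebras. -/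
theorem nonempty_algEquiv_of_homeomorph (hσ : σ ∈ LG) (hτ : τ ∈ LG) (f : σ ≃ₜ τ) :
    Nonempty (AC σ ≃A[ℂ] AC τ) := by
  obtain ⟨hσc, -, T, hT, hσT⟩ := hσ
  obtain ⟨hτc, -, T', hT', hτT'⟩ := hτ
  obtain ⟨V₀, hV₀, hV₀σ, HV⟩ := exists_isGraph hT hσT
  obtain ⟨W₀, hW₀, hW₀τ, HW⟩ := exists_isGraph hT' hτT'
  -- Each vertex set is enlarged by the transported vertices of the other graph, so that both are
  -- large enough and `f` matches them exactly.
  let V : Set ℂ := V₀ ∪ (fun w : τ => (f.symm w : ℂ)) '' ((↑) ⁻¹' W₀)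
  let W : Set ℂ := (fun z : σ => (f z : ℂ)) '' ((↑) ⁻¹' V)
  have hV : V.Finite := hV₀.union ((hW₀.preimage Subtype.val_injective.injOn).image _)
  have hVσ : V ⊆ σ := union_subset hV₀σ (by rintro _ ⟨w, -, rfl⟩; exact (f.symm w).2)
  have hW : W.Finite := (hV.preimage Subtype.val_injective.injOn).image _
  have hWτ : W ⊆ τ := by rintro _ ⟨z, -, rfl⟩; exact (f z).2
  have hW₀W : W₀ ⊆ W := fun w hw => by
    refine ⟨f.symm ⟨w, hW₀τ hw⟩, Or.inr ⟨⟨w, hW₀τ hw⟩, hw, rfl⟩, ?_⟩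
    simp
  have hf : ∀ z : σ, (z : ℂ) ∈ V ↔ (f z : ℂ) ∈ W := fun z => by
    refine ⟨fun hz => ⟨z, hz, rfl⟩, ?_⟩
    rintro ⟨z', hz', e⟩
    rwa [← f.injective (Subtype.ext e)]
  obtain ⟨ι, a, b, hι, hg⟩ := HV V hV subset_union_left hVσ
  obtain ⟨ι', c, d, hι', hg'⟩ := HW W hW hW₀W hWτ
  have hmap := hg.map hg' f hf
  let e : V ≃ W :=
    { toFun := fun v => ⟨f ⟨v, hVσ v.2⟩, (hf _).mp v.2⟩
      invFun := fun w => ⟨f.symm ⟨w, hWτ w.2⟩, (hf _).mpr (by simp)⟩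
      left_inv := fun v => by simp
      right_inv := fun w => by simp }
  obtain ⟨k, hk⟩ := hg.exists_isCellAffine hmap e (fun _ => rfl) (fun _ => rfl)
  have : Finite V := hV
  have hmapc := hmap.isCellDecomp
  have hdec : IsCellDecomp τ (Sum.elim (fun v => (e v : ℂ)) fun i =>
      (f ⟨a i, hg.vertices_subset (hg.left_mem i)⟩ : ℂ)) (Sum.elim (fun v => (e v : ℂ)) fun i =>
      (f ⟨b i, hg.vertices_subset (hg.right_mem i)⟩ : ℂ)) := by
    -- The one-point cells of `τ` are reindexed by `V`, so that both decompositions share one index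
    -- type.
    have h1 := hmapc.comp_equiv (e.sumCongr (Equiv.refl ι))
    convert h1 using 1 <;> ext (v | i) <;> rfl
  exact nonempty_continuousAlgEquiv_of_isCellAffine hσc.isBounded hτc.isBounded hg.isCellDecomp
    hdec k hk

end Graph

end ACSpace

/-- For linear graphs `σ`, `τ` in the plane, `AC(σ)` and `AC(τ)` are isomorphic as Banach algebras
(by an algebra isomorphism that is continuous in both directions for the variation norms) if and
only if `σ` and `τ` are homeomorphic. -/
theorem mainTheorem1 (σ τ : Set ℂ) (hσ : σ ∈ ACSpace.LG) (hτ : τ ∈ ACSpace.LG) :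
    Nonempty (ACSpace.AC σ ≃A[ℂ] ACSpace.AC τ) ↔ Nonempty (σ ≃ₜ τ) := by
  refine ⟨fun ⟨Φ⟩ => ?_, fun ⟨f⟩ => ACSpace.nonempty_algEquiv_of_homeomorph hσ hτ f⟩
  exact ACSpace.nonempty_homeomorph_of_algEquiv hσ.1 hσ.2.1.nonempty hτ.1 hτ.2.1.nonempty Φ
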